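/- **Model.** Fix $\delta_1,\delta_2\in[0,1)$ and $\epsilon_1,\epsilon_2\in[0,1]$; for $i\in\{1,2\}$ put $\bar\imath=3-i$. A transmitter sends $X[1],\dots,X[n]\in\mathbb F_2$; receiver $i$ observes $Y_i[t]=S_i[t]X[t]$ together with $S_i[t]$, where $S_i[t]\sim\mathrm{Bernoulli}(1-\delta_i)$. Message $W_i$ (intended for receiver $i$) consists of $\lfloor nR_i\rfloor$ uniform bits. Receiver $i$ has cached the bits $E_i[\ell]W_{\bar\imath}[\ell]$ of the other message, with cache index information $E_i[\ell]\sim\mathrm{Bernoulli}(1-\epsilon_i)$ known to receiver $i$. All $S_i[t]$, $E_i[\ell]$ and message bits are independent. There is no channel state information at the transmitter. A *non-blind* transmitter uses block encoders $X^n=f(W_1,W_2,E_1,E_2)$; a transmitter that is *semi-blind and knows the cache index information of receiver $w$ only* uses block encoders $X^n=f(W_1,W_2,E_w)$. Receiver $i$ estimates $W_i$ from $Y_i^n$, $S_i^n$, its cached bits, $E_i$, and the cache index sequences on which the encoder depends (both $E_1,E_2$ in the non-blind case, $E_w$ in the semi-blind case). Encoders and decoders may depend on $\delta_1,\delta_2,\epsilon_1,\epsilon_2$.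 A pair $(R_1,R_2)$ with $R_1,R_2\ge 0$ is achievable if there are codes, one for each block length $n$, for which both error probabilities $P(\widehat W_i\ne W_i)$, $i=1,2$, tend to $0$ as $n\to\infty$. The capacity region is the closure of the set of achievable pairs; it is denoted $\mathcal C^{\mathrm{non-blind}}_{\mathrm{NN}}$ for a non-blind transmitter, and $\mathcal C^{\mathrm{semi-blind},w}_{\mathrm{NN}}$ for a semi-blind transmitter that knows the cache index information of receiver $w$ only. **Claim.** Let $w$ be the weaker receiver, i.e. $\delta_w\ge\delta_{\bar w}$. Then $$\mathcal C^{\mathrm{semi-blind},w}_{\mathrm{NN}}=\mathcal C^{\mathrm{non-blind}}_{\mathrm{NN}}=\Big\{(R_1,R_2):\ R_1,R_2\ge 0,\ \ \beta_1R_1+R_2\le 1-\delta_2,\ \ R_1+\beta_2R_2\le 1-\delta_1\Big\},$$ where $\beta_i=\epsilon_{\bar\imath}\min\Big\{\dfrac{1-\delta_{\bar\imath}}{1-\delta_i},\,1\Big\}$. -/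

import Mathlib

open Filter Topology

noncomputable section

namespace ErasureBC

/-! Two-user broadcast erasure channel with random receiver caches and no channel state
information at the transmitter.  Receivers are indexed by `Fin 2`; the receiver other than `i` is
`i.rev`. Message `i` is a string of `m i` bits intended for receiver `i`. -/

/-- A pair of messages. -/
abbrev Messages (m : Fin 2 → ℕ) : Type := ∀ i : Fin 2, Fin (m i) → ZMod 2

/-- Cache index information: `E i ℓ` tells whether receiver `i` has cached bit `ℓ` of the message
intended for the other receiver. -/
abbrev CacheIndex (m : Fin 2 → ℕ) : Type := ∀ i : Fin 2, Fin (m i.rev) → Bool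

/-- The cache indices of the receivers in `T` only. -/
abbrev CacheIndexOf (T : Set (Fin 2)) (m : Fin 2 → ℕ) : Type :=
  ∀ i : T, Fin (m (i : Fin 2).rev) → Bool

/-- Erasure states: `S i t = true` iff receiver `i` receives the symbol sent at time `t`. -/
abbrev ChannelState (n : ℕ) : Type := Fin 2 → Fin n → Bool

/-- The bits of `x` selected by `s`, the other positions being replaced by `0`: the product
`s · x` over the binary field. -/
def mask {k : ℕ} (s : Fin k → Bool) (x : Fin k → ZMod 2) : Fin k → ZMod 2 :=
  fun ℓ => if s ℓ then x ℓ else 0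

/-- A block code of length `n` without channel state information at the transmitter, where `T` is
the set of receivers whose cache index information the transmitter knows (`T = ∅`: blind,
`T = {i}`: semi-blind, `T = Set.univ`: non-blind).

* The channel input is a function of the messages and of the cache indices of the receivers in `T`.
* Receiver `i` decodes from its channel output `Yᵢⁿ`, its erasure states `Sᵢⁿ`, its cached bits,
  its cache index information, and the cache indices on which the transmitted
  codeword depends. -/
structure Code (T : Set (Fin 2)) (m : Fin 2 → ℕ) (n : ℕ) where
  /-- the encoder -/
  enc : Messages m → CacheIndexOf T m → Fin n → ZMod 2
  /-- the decoders -/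
  dec : ∀ i : Fin 2, (Y : Fin n → ZMod 2) → (S : Fin n → Bool) →
    (cache : Fin (m i.rev) → ZMod 2) → (Eown : Fin (m i.rev) → Bool) →
    (ETx : CacheIndexOf T m) → Fin (m i) → ZMod 2

/-- The channel input. -/
def Code.input {T : Set (Fin 2)} {m : Fin 2 → ℕ} {n : ℕ} (c : Code T m n)
    (W : Messages m) (E : CacheIndex m) : Fin n → ZMod 2 :=
  c.enc W (fun j => E j)

/-- The estimate of message `i` formed by receiver `i`. -/
def Code.estimate {T : Set (Fin 2)} {m : Fin 2 → ℕ} {n : ℕ} (c : Code T m n) (i : Fin 2)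
    (W : Messages m) (E : CacheIndex m) (S : ChannelState n) : Fin (m i) → ZMod 2 :=
  c.dec i (mask (S i) (c.input W E)) (S i) (mask (E i) (W i.rev)) (E i) (fun j => E j)

/-- Probability of the value `b` under the Bernoulli law with parameter `p`. -/
def bernoulliWeight (p : ℝ) (b : Bool) : ℝ := if b then p else 1 - p

/-- Probability of `(W, E, S)`: the messages are uniform, `E i ℓ` is Bernoulli `(1 - ε i)`,
`S i t` is Bernoulli `(1 - δ i)`, and all these variables are independent. -/
def weight (δ ε : Fin 2 → ℝ) {m : Fin 2 → ℕ} {n : ℕ}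
    (_W : Messages m) (E : CacheIndex m) (S : ChannelState n) : ℝ :=
  (Fintype.card (Messages m) : ℝ)⁻¹
    * (∏ i : Fin 2, ∏ ℓ : Fin (m i.rev), bernoulliWeight (1 - ε i) (E i ℓ))
    * (∏ i : Fin 2, ∏ t : Fin n, bernoulliWeight (1 - δ i) (S i t))

/-- Average error probability at receiver `i`. -/
def errorProb (δ ε : Fin 2 → ℝ) {T : Set (Fin 2)} {m : Fin 2 → ℕ} {n : ℕ} (c : Code T m n)
    (i : Fin 2) : ℝ :=
  ∑ W : Messages m, ∑ E : CacheIndex m, ∑ S : ChannelState n,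
    if c.estimate i W E S ≠ W i then weight δ ε W E S else 0

/-- Achievable rate pairs: at block length `n`, message `i` has `⌊n Rᵢ⌋` bits. -/
def Achievable (T : Set (Fin 2)) (δ ε : Fin 2 → ℝ) (R : Fin 2 → ℝ) : Prop :=
  (∀ i, 0 ≤ R i) ∧
    ∃ c : ∀ n : ℕ, Code T (fun i => ⌊(n : ℝ) * R i⌋₊) n,
      ∀ i, Tendsto (fun n => errorProb δ ε (c n) i) atTop (𝓝 0)

/-- The capacity region without channel state information at the transmitter, when the
transmitter knows the cache indices of the receivers in `T`. -/
def capacityRegion (T : Set (Fin 2)) (δ ε : Fin 2 → ℝ) : Set (Fin 2 → ℝ) :=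
  closure {R | Achievable T δ ε R}

/-- Non-blind transmitter, no channel state information. -/
def nonBlindRegion (δ ε : Fin 2 → ℝ) : Set (Fin 2 → ℝ) := capacityRegion Set.univ δ ε

/-- Semi-blind transmitter knowing the cache indices of receiver `w` only, no channel state
information. -/
def semiBlindRegion (w : Fin 2) (δ ε : Fin 2 → ℝ) : Set (Fin 2 → ℝ) := capacityRegion {w} δ ε

/-- The coefficient `βᵢ = ε_{ī} min {(1 - δ_{ī}) / (1 - δᵢ), 1}`. -/
def beta (δ ε : Fin 2 → ℝ) (i : Fin 2) : ℝ :=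
  ε i.rev * min ((1 - δ i.rev) / (1 - δ i)) 1

/-- The region `βᵢ Rᵢ + R_{ī} ≤ 1 - δ_{ī}`, `i = 1, 2`, in the nonnegative quadrant. -/
def polytope (δ ε : Fin 2 → ℝ) : Set (Fin 2 → ℝ) :=
  {R | (∀ i, 0 ≤ R i) ∧ ∀ i, beta δ ε i * R i + R i.rev ≤ 1 - δ i.rev}

end ErasureBC

end

/-! Converse. Fix the cache indices and let h(A) be the conditional entropy of the channel inputs at
the times in A, given message `j` and the bits of the other message cached at receiver `j`. Fano's
inequality at receiver `j` bounds h(S_j) above by about |S_j| - m_j bits (`outputEntropy_le`).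
Fano's inequality at the other receiver, helped by all of message `j` and those cached bits, bounds
h at its own reception set below by about the number of bits that receiver `j` has not cached
(`le_outputEntropy`). The encoder does not see the erasures, so h is one fixed set function, and
both bounds average to means of h over Bernoulli sets, with parameters p_j and p_j̄, where p_i = 1 -
δ_i. As h is monotone and submodular, this mean increases with the parameter
(`bernoulliMean_mono_param`), while its quotient by the parameter decreases (`bernoulliMean_ratio`).
Comparing the two means produces the factor min(p_j / p_j̄, 1). Nothing here depends on which cache
indices the encoder knows.

Achievability. A random linear code with two phases needs only the cache indices of `w`. Phase one,
a fraction τ of the time, combines the bits for w̄ that `w` has not cached; `w` ignores it. Phase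
two combines all remaining bits; `w` knows those intended for w̄ and has only its own message to
solve for, while w̄ solves for its remaining bits and the bits of message `w` missing from its
cache. Decoding succeeds if ε_w R_w̄ < τ p_w̄, (1 - ε_w) R_w̄ + ε_w̄ R_w < (1 - τ) p_w̄ and R_w < (1
- τ) p_w. Such a τ exists exactly when two linear inequalities hold strictly, and for the weaker
receiver `w` these are the two inequalities of the polytope (`achievable_of_lt`,
`polytope_subset_semiBlindRegion`).

Extra side information cannot shrink the region, so the semi-blind region lies between the polytope
and the non-blind region, which lies in the polytope. -/

namespace ErasureBC

/-! ### Entropy on a finite uniform space: Gibbs, submodularity, Fano. -/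

section Entropy

variable {Ω α β γ : Type*} [Fintype Ω]

open Classical in
/-- The size of the level set of `f` through `ω`. -/
noncomputable def fiberCard (f : Ω → α) (ω : Ω) : ℝ :=
  ∑ ω' : Ω, if f ω' = f ω then 1 else 0

/-- The entropy (in nats) of a function on a finite probability space with the uniform law. -/
noncomputable def entropy (f : Ω → α) : ℝ :=
  (Fintype.card Ω : ℝ)⁻¹ * ∑ ω, Real.log (Fintype.card Ω / fiberCard f ω)

lemma fiberCard_pos (f : Ω → α) (ω : Ω) : 0 < fiberCard f ω := by
  classical
  have h := Finset.single_le_sum (f := fun ω' => if f ω' = f ω then (1 : ℝ) else 0)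
    (fun i _ => by positivity) (Finset.mem_univ ω)
  simp only [if_true] at h
  unfold fiberCard
  convert lt_of_lt_of_le one_pos h

lemma fiberCard_congr {f : Ω → α} {ω ω' : Ω} (h : f ω = f ω') :
    fiberCard f ω = fiberCard f ω' := by
  unfold fiberCard
  rw [h]

/-- Each nonempty level set contributes exactly 1, being counted with the inverse of its size. This
replaces sums over the image of `f` in what follows. -/
lemma sum_inv_fiberCard_le [DecidableEq α] (f : Ω → α) (a : α) :
    ∑ ω, (if f ω = a then (fiberCard f ω)⁻¹ else 0) ≤ 1 := by
  by_cases h : ∃ ω, f ω = a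
  · obtain ⟨ω₀, rfl⟩ := h
    have : ∀ ω, (if f ω = f ω₀ then (fiberCard f ω)⁻¹ else 0)
        = (fiberCard f ω₀)⁻¹ * (if f ω = f ω₀ then 1 else 0) := by
      intro ω
      split_ifs with h
      · rw [fiberCard_congr h, mul_one]
      · simp
    simp_rw [this, ← Finset.mul_sum]
    have h1 : ∑ ω, (if f ω = f ω₀ then (1 : ℝ) else 0) = fiberCard f ω₀ :=
      Finset.sum_congr rfl fun ω _ => by congr
    rw [h1, inv_mul_cancel₀ (fiberCard_pos f ω₀).ne']
  · push Not at h
    simp [h]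

/-- Gibbs' inequality. -/
lemma entropy_sub_le (f : Ω → α) (g : Ω → β) (q : Ω → ℝ) (hq : ∀ ω, 0 < q ω)
    (h : ∑ ω, fiberCard g ω * (fiberCard f ω)⁻¹ * q ω ≤ Fintype.card Ω) :
    entropy f - entropy g ≤ (Fintype.card Ω : ℝ)⁻¹ * ∑ ω, -Real.log (q ω) := by
  unfold entropy
  rw [← mul_sub, ← Finset.sum_sub_distrib]
  refine mul_le_mul_of_nonneg_left ?_ (by positivity)
  -- This is `log x ≤ x - 1` at the summand of the hypothesis; `q` plays the role of a conditional
  -- law of `f` given `g`.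
  have key : ∀ ω, Real.log (Fintype.card Ω / fiberCard f ω)
      - Real.log (Fintype.card Ω / fiberCard g ω)
      ≤ fiberCard g ω * (fiberCard f ω)⁻¹ * q ω - 1 + -Real.log (q ω) := by
    intro ω
    have hN : (Fintype.card Ω : ℝ) ≠ 0 := by
      have : Nonempty Ω := ⟨ω⟩
      exact_mod_cast Fintype.card_ne_zero
    have hf := fiberCard_pos f ω
    have hg := fiberCard_pos g ω
    have h1 := Real.log_le_sub_one_of_pos (x := fiberCard g ω * (fiberCard f ω)⁻¹ * q ω)
      (by have := hq ω; positivity)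
    rw [Real.log_mul (by positivity) (hq ω).ne', Real.log_mul hg.ne' (by positivity),
      Real.log_inv] at h1
    rw [Real.log_div hN hf.ne', Real.log_div hN hg.ne']
    linarith
  refine (Finset.sum_le_sum fun ω _ => key ω).trans ?_
  rw [Finset.sum_add_distrib, Finset.sum_sub_distrib]
  simp only [Finset.sum_const, Finset.card_univ, nsmul_eq_mul, mul_one]
  linarith

lemma entropy_mono {f : Ω → α} {g : Ω → β} (h : f.FactorsThrough g) :
    entropy f ≤ entropy g := by
  unfold entropy
  refine mul_le_mul_of_nonneg_left (Finset.sum_le_sum fun ω _ => ?_) (by positivity)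
  have : Nonempty Ω := ⟨ω⟩
  have hN : (0 : ℝ) < Fintype.card Ω := by exact_mod_cast Fintype.card_pos
  refine Real.log_le_log (div_pos hN (fiberCard_pos f ω))
    (div_le_div_of_nonneg_left hN.le (fiberCard_pos g ω) ?_)
  unfold fiberCard
  refine Finset.sum_le_sum fun ω' _ => ?_
  by_cases hg : g ω' = g ω
  · simp [hg, h hg]
  · rw [if_neg hg]; positivity

lemma entropy_const (a : α) : entropy (fun _ : Ω => a) = 0 := by
  unfold entropy fiberCard
  simp only [if_true, Finset.sum_const, Finset.card_univ, nsmul_eq_mul, mul_one]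
  by_cases h : (Fintype.card Ω : ℝ) = 0
  · simp [h]
  · simp [div_self h]

lemma entropy_of_injective {f : Ω → α} (hf : f.Injective) :
    entropy f = Real.log (Fintype.card Ω) := by
  classical
  have : ∀ ω, fiberCard f ω = 1 := by
    intro ω
    unfold fiberCard
    rw [Finset.sum_eq_single ω]
    · simp
    · intro b _ hb
      simp [hf.ne hb]
    · simp
  unfold entropy
  simp only [this, div_one, Finset.sum_const, Finset.card_univ, nsmul_eq_mul]
  by_cases h : (Fintype.card Ω : ℝ) = 0
  · simp [h]
  · field_simp

/-- Conditioning on more reduces entropy: H(u | v) ≤ H(u | k) because `v` determines `k`. It is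
Gibbs' inequality with the conditional law of `u` given `k` as the test law. -/
lemma entropy_pair_add_le {u : Ω → α} {v : Ω → β} {k : Ω → γ}
    (hu : k.FactorsThrough u) (hv : k.FactorsThrough v) :
    entropy (fun ω => (u ω, v ω)) + entropy k ≤ entropy u + entropy v := by
  classical
  set j : Ω → α × β := fun ω => (u ω, v ω) with hj
  have hpos := fun ω => div_pos (fiberCard_pos u ω) (fiberCard_pos k ω)
  have h := entropy_sub_le j v (fun ω => fiberCard u ω / fiberCard k ω) hpos ?_
  · have h2 : (Fintype.card Ω : ℝ)⁻¹ * ∑ ω, -Real.log (fiberCard u ω / fiberCard k ω)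
        = entropy u - entropy k := by
      unfold entropy
      rw [← mul_sub, ← Finset.sum_sub_distrib]
      congr 1
      refine Finset.sum_congr rfl fun ω _ => ?_
      have hN : (Fintype.card Ω : ℝ) ≠ 0 := by
        have : Nonempty Ω := ⟨ω⟩
        exact_mod_cast Fintype.card_ne_zero
      rw [Real.log_div (fiberCard_pos u ω).ne' (fiberCard_pos k ω).ne',
        Real.log_div hN (fiberCard_pos u ω).ne', Real.log_div hN (fiberCard_pos k ω).ne']
      ring
    linarith
  · calc ∑ ω, fiberCard v ω * (fiberCard j ω)⁻¹ * (fiberCard u ω / fiberCard k ω)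
        = ∑ ω, ∑ ω₁, ∑ ω₂, (if v ω₁ = v ω then 1 else 0) * (if u ω₂ = u ω then 1 else 0)
            * ((fiberCard j ω)⁻¹ * (fiberCard k ω)⁻¹) := by
          refine Finset.sum_congr rfl fun ω _ => ?_
          simp_rw [← Finset.sum_mul, ← Finset.mul_sum, ← Finset.sum_mul]
          unfold fiberCard
          ring
      _ = ∑ ω₁, ∑ ω₂, ∑ ω, (if v ω₁ = v ω then 1 else 0) * (if u ω₂ = u ω then 1 else 0)
            * ((fiberCard j ω)⁻¹ * (fiberCard k ω)⁻¹) := by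
          rw [Finset.sum_comm]
          exact Finset.sum_congr rfl fun ω₁ _ => Finset.sum_comm
      -- A nonzero term forces `ω₁` and `ω₂` into the same level set of `k`, and the sum over `ω`
      -- then runs over a single level set of the pair.
      _ ≤ ∑ ω₁, ∑ ω₂, (if k ω₂ = k ω₁ then 1 else 0) * (fiberCard k ω₁)⁻¹ := by
          refine Finset.sum_le_sum fun ω₁ _ => Finset.sum_le_sum fun ω₂ _ => ?_
          have h1 : ∀ ω, (if v ω₁ = v ω then (1 : ℝ) else 0) * (if u ω₂ = u ω then 1 else 0)
              * ((fiberCard j ω)⁻¹ * (fiberCard k ω)⁻¹)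
              = (if j ω = (u ω₂, v ω₁) then (fiberCard j ω)⁻¹ else 0)
                * ((if k ω₂ = k ω₁ then 1 else 0) * (fiberCard k ω₁)⁻¹) := by
            intro ω
            by_cases h1 : v ω₁ = v ω
            · by_cases h2 : u ω₂ = u ω
              · have e1 : k ω₁ = k ω := hv h1
                have e2 : k ω₂ = k ω := hu h2
                simp [hj, h1, h2, e1, e2, fiberCard_congr e1]
              · simp [hj, h2, Ne.symm h2]
            · simp [hj, h1, Ne.symm h1]
          simp_rw [h1, ← Finset.sum_mul]
          refine mul_le_of_le_one_left ?_ (sum_inv_fiberCard_le j _)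
          have := fiberCard_pos k ω₁
          positivity
      _ = ∑ ω₁ : Ω, (1 : ℝ) := by
          refine Finset.sum_congr rfl fun ω₁ _ => ?_
          rw [← Finset.sum_mul]
          exact mul_inv_cancel₀ (fiberCard_pos k ω₁).ne'
      _ = Fintype.card Ω := by simp

/-- Submodularity of entropy. -/
lemma entropy_submodular {δ : Type*} {u : Ω → α} {v : Ω → β} {k : Ω → γ} {j : Ω → δ}
    (hu : k.FactorsThrough u) (hv : k.FactorsThrough v)
    (hj : j.FactorsThrough fun ω => (u ω, v ω)) :
    entropy j + entropy k ≤ entropy u + entropy v :=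
  (add_le_add_left (entropy_mono hj) _).trans (entropy_pair_add_le hu hv)

lemma entropy_le_add {u : Ω → α} {v : Ω → β} {j : Ω → γ}
    (hj : j.FactorsThrough fun ω => (u ω, v ω)) :
    entropy j ≤ entropy u + entropy v := by
  have := entropy_submodular (k := fun _ => ()) (fun _ _ _ => rfl) (fun _ _ _ => rfl) hj
  rwa [entropy_const, add_zero] at this

lemma entropy_le_log_card [Fintype α] [Nonempty α] (f : Ω → α) :
    entropy f ≤ Real.log (Fintype.card α) := by
  classical
  have hM : (0 : ℝ) < Fintype.card α := by exact_mod_cast Fintype.card_pos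
  have h := entropy_sub_le f (fun _ : Ω => ()) (fun _ => (Fintype.card α : ℝ)⁻¹)
    (fun _ => by positivity) ?_
  · rw [entropy_const, sub_zero] at h
    refine h.trans ?_
    simp only [Real.log_inv, neg_neg, Finset.sum_const, Finset.card_univ, nsmul_eq_mul]
    by_cases h0 : (Fintype.card Ω : ℝ) = 0
    · simpa [h0] using Real.log_natCast_nonneg _
    · rw [inv_mul_cancel_left₀ h0]
  · have h1 : ∀ ω, fiberCard (fun _ : Ω => ()) ω = Fintype.card Ω := by
      intro ω; simp [fiberCard]
    have h2 : ∑ ω, (fiberCard f ω)⁻¹ ≤ Fintype.card α := by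
      calc ∑ ω, (fiberCard f ω)⁻¹ = ∑ ω, ∑ a, if f ω = a then (fiberCard f ω)⁻¹ else 0 := by simp
        _ = ∑ a, ∑ ω, if f ω = a then (fiberCard f ω)⁻¹ else 0 := Finset.sum_comm
        _ ≤ ∑ _a : α, (1 : ℝ) := Finset.sum_le_sum fun a _ => sum_inv_fiberCard_le f a
        _ = Fintype.card α := by simp
    simp_rw [h1, ← Finset.sum_mul, ← Finset.mul_sum]
    rw [mul_assoc]
    refine mul_le_of_le_one_right (by positivity) ?_
    rw [← div_eq_mul_inv, div_le_one hM]
    exact h2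

/-- Fano's inequality. -/
lemma fano [Fintype α] [Nonempty α] [DecidableEq α] {f est : Ω → α} {g : Ω → β}
    (hest : est.FactorsThrough g) :
    entropy (fun ω => (f ω, g ω)) - entropy g ≤ Real.log 2
      + ((Fintype.card Ω : ℝ)⁻¹ * ∑ ω, if est ω ≠ f ω then 1 else 0)
        * Real.log (Fintype.card α) := by
  classical
  have hM : (0 : ℝ) < Fintype.card α := by exact_mod_cast Fintype.card_pos
  set M : ℝ := (Fintype.card α : ℝ) with hMdef
  set j : Ω → α × β := fun ω => (f ω, g ω) with hj
  -- Test law: half the mass on the estimate, the other half spread uniformly over all values. The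
  -- mass `1/(2M)` that the estimate gets from the uniform half is dropped.
  set q : Ω → ℝ := fun ω => if est ω ≠ f ω then (2 * M)⁻¹ else 2⁻¹ with hqdef
  have hqpos : ∀ ω, 0 < q ω := fun ω => by
    simp only [hqdef]; split_ifs <;> positivity
  have hlog2 : 0 ≤ Real.log 2 := Real.log_nonneg (by norm_num)
  refine (entropy_sub_le j g q hqpos ?_).trans ?_
  · calc ∑ ω, fiberCard g ω * (fiberCard j ω)⁻¹ * q ω
        = ∑ ω, ∑ ω₁, (if g ω₁ = g ω then 1 else 0) * ((fiberCard j ω)⁻¹ * q ω) := by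
          refine Finset.sum_congr rfl fun ω _ => ?_
          rw [← Finset.sum_mul, mul_assoc]; rfl
      _ = ∑ ω₁, ∑ ω, (if g ω₁ = g ω then 1 else 0) * ((fiberCard j ω)⁻¹ * q ω) :=
          Finset.sum_comm
      _ ≤ ∑ _ω₁ : Ω, (1 : ℝ) := by
          refine Finset.sum_le_sum fun ω₁ _ => ?_
          calc ∑ ω, (if g ω₁ = g ω then 1 else 0) * ((fiberCard j ω)⁻¹ * q ω)
              = ∑ ω, ∑ a, (if j ω = (a, g ω₁) then (fiberCard j ω)⁻¹ else 0)
                  * (if est ω₁ ≠ a then (2 * M)⁻¹ else 2⁻¹) := by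
                refine Finset.sum_congr rfl fun ω _ => ?_
                rw [Finset.sum_eq_single (f ω)]
                · by_cases h : g ω₁ = g ω
                  · simp [hj, h, hqdef, hest h]
                  · simp [hj, h, Ne.symm h]
                · intro a _ ha
                  simp [hj, Ne.symm ha]
                · simp
            _ = ∑ a, (∑ ω, if j ω = (a, g ω₁) then (fiberCard j ω)⁻¹ else 0)
                  * (if est ω₁ ≠ a then (2 * M)⁻¹ else 2⁻¹) := by
                rw [Finset.sum_comm]
                simp_rw [Finset.sum_mul]
            _ ≤ ∑ a, ((2 * M)⁻¹ + if est ω₁ = a then 2⁻¹ else 0) := by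
                refine Finset.sum_le_sum fun a _ => ?_
                refine (mul_le_of_le_one_left ?_
                  (sum_inv_fiberCard_le j _)).trans ?_
                · split_ifs <;> positivity
                · by_cases h : est ω₁ = a
                  · simp only [h, ne_eq, not_true_eq_false, if_false, if_true]
                    have : 0 < (2 * M)⁻¹ := by positivity
                    linarith
                  · simp [h]
            _ = 1 := by
                rw [Finset.sum_add_distrib]
                simp only [Finset.sum_const, Finset.card_univ, nsmul_eq_mul, Finset.sum_ite_eq,
                  Finset.mem_univ, if_true]
                rw [← hMdef]
                field_simp
                norm_num
      _ = Fintype.card Ω := by simp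
  · have h1 : ∀ ω, -Real.log (q ω)
        = Real.log 2 + (if est ω ≠ f ω then 1 else 0) * Real.log M := by
      intro ω
      simp only [hqdef]
      split_ifs
      · rw [Real.log_inv, Real.log_mul two_ne_zero hM.ne']; ring
      · rw [Real.log_inv]; ring
    simp_rw [h1, Finset.sum_add_distrib, ← Finset.sum_mul]
    rw [mul_add, ← mul_assoc]
    refine add_le_add_left ?_ _
    simp only [Finset.sum_const, Finset.card_univ, nsmul_eq_mul]
    by_cases h0 : (Fintype.card Ω : ℝ) = 0
    · simpa [h0] using hlog2
    · rw [inv_mul_cancel_left₀ h0]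

end Entropy

/-! ### Means of monotone and submodular functions over Bernoulli random sets. -/

section BernoulliMean

variable {n : ℕ} {p q : ℝ}

/-- The mean of `h` over a string of independent Bernoulli variables with parameter `p`. -/
noncomputable def bernoulliMean (p : ℝ) (h : (Fin n → Bool) → ℝ) : ℝ :=
  ∑ A : Fin n → Bool, (∏ t, bernoulliWeight p (A t)) * h A

lemma bernoulliWeight_nonneg (hp : 0 ≤ p ∧ p ≤ 1) (b : Bool) : 0 ≤ bernoulliWeight p b := by
  unfold bernoulliWeight
  split_ifs <;> linarith [hp.1, hp.2]

lemma bernoulliMean_zero (h : (Fin 0 → Bool) → ℝ) : bernoulliMean p h = h ⊥ := by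
  unfold bernoulliMean
  rw [Fintype.sum_unique]
  simp only [Finset.univ_eq_empty, Finset.prod_empty, one_mul]
  exact congrArg h (Subsingleton.elim _ _)

lemma bernoulliMean_succ (h : (Fin (n + 1) → Bool) → ℝ) :
    bernoulliMean p h = p * bernoulliMean p (fun A => h (Fin.cons true A))
      + (1 - p) * bernoulliMean p (fun A => h (Fin.cons false A)) := by
  unfold bernoulliMean
  rw [← (Fin.consEquiv fun _ => Bool).sum_comp, Fintype.sum_prod_type, Fintype.sum_bool,
    Finset.mul_sum, Finset.mul_sum]
  congr 1 <;>
  · refine Finset.sum_congr rfl fun A _ => ?_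
    simp only [Fin.consEquiv, Equiv.coe_fn_mk, Fin.prod_univ_succ, Fin.cons_zero, Fin.cons_succ,
      bernoulliWeight]
    simp only [if_true, Bool.false_eq_true, if_false, mul_assoc]

lemma bernoulliMean_le (hp : 0 ≤ p ∧ p ≤ 1) {h h' : (Fin n → Bool) → ℝ} (hh : ∀ A, h A ≤ h' A) :
    bernoulliMean p h ≤ bernoulliMean p h' :=
  Finset.sum_le_sum fun A _ => mul_le_mul_of_nonneg_left (hh A)
    (Finset.prod_nonneg fun _ _ => bernoulliWeight_nonneg hp _)

lemma bernoulliMean_sub (h h' : (Fin n → Bool) → ℝ) :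
    bernoulliMean p (fun A => h A - h' A) = bernoulliMean p h - bernoulliMean p h' := by
  simp only [bernoulliMean, mul_sub, Finset.sum_sub_distrib]

lemma bernoulliMean_add (h h' : (Fin n → Bool) → ℝ) :
    bernoulliMean p (fun A => h A + h' A) = bernoulliMean p h + bernoulliMean p h' := by
  simp only [bernoulliMean, mul_add, Finset.sum_add_distrib]

/-- Mean of a product of functions of the individual variables. -/
lemma bernoulliMean_prod (g : Fin n → Bool → ℝ) :
    bernoulliMean p (fun A => ∏ t, g t (A t)) = ∏ t, (p * g t true + (1 - p) * g t false) := by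
  unfold bernoulliMean
  simp_rw [← Finset.prod_mul_distrib]
  rw [← Fintype.prod_sum fun t b => bernoulliWeight p b * g t b]
  simp [bernoulliWeight]

lemma bernoulliMean_const (c : ℝ) : bernoulliMean p (fun _ : Fin n → Bool => c) = c := by
  have h := bernoulliMean_prod (p := p) (n := n) fun _ _ => 1
  unfold bernoulliMean at *
  rw [← Finset.sum_mul]
  simp only [Finset.prod_const_one, mul_one] at h
  rw [h]
  simp

lemma bernoulliMean_count :
    bernoulliMean p (fun A : Fin n → Bool => ∑ t, if A t then (1 : ℝ) else 0) = n * p := by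
  induction n with
  | zero => simp [bernoulliMean_zero]
  | succ n ih =>
    rw [bernoulliMean_succ]
    simp only [Fin.sum_univ_succ, Fin.cons_zero, Fin.cons_succ, if_true, Bool.false_eq_true,
      if_false, zero_add, ih]
    rw [bernoulliMean_add, bernoulliMean_const, ih]
    push_cast
    ring

lemma cons_le_cons_bool {b b' : Bool} {A B : Fin n → Bool} (hb : b ≤ b') (h : A ≤ B) :
    (Fin.cons b A : Fin (n + 1) → Bool) ≤ Fin.cons b' B :=
  Fin.cons_le_cons.2 ⟨hb, h⟩

/-- Condition on the first coordinate: raising the parameter increases both conditional means by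
induction, and moves weight to the larger of the two. -/
lemma bernoulliMean_mono_param (hp : 0 ≤ p) (hpq : p ≤ q) (hq : q ≤ 1)
    {h : (Fin n → Bool) → ℝ} (hh : Monotone h) : bernoulliMean p h ≤ bernoulliMean q h := by
  induction n with
  | zero => simp [bernoulliMean_zero]
  | succ n ih =>
    have h1 := ih (h := fun A => h (Fin.cons true A))
      fun A B hAB => hh (cons_le_cons_bool le_rfl hAB)
    have h0 := ih (h := fun A => h (Fin.cons false A))
      fun A B hAB => hh (cons_le_cons_bool le_rfl hAB)
    have h01 := bernoulliMean_le (p := q) ⟨hp.trans hpq, hq⟩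
      (h := fun A => h (Fin.cons false A)) (h' := fun A => h (Fin.cons true A))
      fun A => hh (cons_le_cons_bool (Bool.false_le _) le_rfl)
    rw [bernoulliMean_succ, bernoulliMean_succ]
    nlinarith [mul_le_mul_of_nonneg_left h1 hp,
      mul_le_mul_of_nonneg_left h0 (sub_nonneg.2 (hpq.trans hq)),
      mul_nonneg (sub_nonneg.2 hpq) (sub_nonneg.2 h01)]

/-- For a submodular function, the mean over a random set grows at most linearly in the
inclusion probability. -/
lemma bernoulliMean_ratio (hp : 0 ≤ p) (hpq : p ≤ q) (hq : q ≤ 1)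
    {h : (Fin n → Bool) → ℝ} (h0 : 0 ≤ h ⊥)
    (hsub : ∀ A B, h (A ⊔ B) + h (A ⊓ B) ≤ h A + h B) :
    p * bernoulliMean q h ≤ q * bernoulliMean p h := by
  induction n with
  | zero =>
    rw [bernoulliMean_zero, bernoulliMean_zero]
    exact mul_le_mul_of_nonneg_right hpq h0
  | succ n ih =>
    have hbot : (Fin.cons false ⊥ : Fin (n + 1) → Bool) = ⊥ := by
      funext t; refine Fin.cases ?_ (fun _ => ?_) t <;> simp
    have hsup : ∀ (a b : Bool) (A B : Fin n → Bool),
        (Fin.cons a A ⊔ Fin.cons b B : Fin (n + 1) → Bool) = Fin.cons (a ⊔ b) (A ⊔ B) := by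
      intro a b A B
      funext t; refine Fin.cases ?_ (fun _ => ?_) t <;> simp
    have hinf : ∀ (a b : Bool) (A B : Fin n → Bool),
        (Fin.cons a A ⊓ Fin.cons b B : Fin (n + 1) → Bool) = Fin.cons (a ⊓ b) (A ⊓ B) := by
      intro a b A B
      funext t; refine Fin.cases ?_ (fun _ => ?_) t <;> simp
    have i0 := ih (h := fun A => h (Fin.cons false A)) (by simpa [hbot] using h0) (by
      intro A B
      have := hsub (Fin.cons false A) (Fin.cons false B)
      rwa [hsup, hinf] at this)
    -- Diminishing returns: by submodularity, the gain from including the first position decreases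
    -- with the rest of the set, so its negative is monotone. The mean of `h` is the mean without
    -- the first position plus the parameter times the mean gain; `i0` treats the former, `i1` the
    -- latter.
    have i1 := bernoulliMean_mono_param hp hpq hq
      (h := fun A => h (Fin.cons false A) - h (Fin.cons true A)) (by
        intro A B hAB
        have := hsub (Fin.cons true A) (Fin.cons false B)
        rw [hsup, hinf, sup_eq_right.2 hAB, inf_eq_left.2 hAB] at this
        simp only [sup_of_le_left (Bool.false_le true), inf_of_le_right (Bool.false_le true)]
          at this
        dsimp only
        linarith)
    rw [bernoulliMean_sub, bernoulliMean_sub] at i1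
    rw [bernoulliMean_succ, bernoulliMean_succ]
    nlinarith [mul_le_mul_of_nonneg_left i1 (mul_nonneg hp (hp.trans hpq))]

/-- Means over a pair of independent Bernoulli strings. -/
lemma sum_pair_bernoulli (p : Fin 2 → ℝ) (k : Fin 2 → ℕ) (j : Fin 2)
    (φ : (Fin (k j) → Bool) → ℝ) (ψ : (Fin (k j.rev) → Bool) → ℝ) :
    ∑ S : ∀ i : Fin 2, Fin (k i) → Bool, (∏ i, ∏ t, bernoulliWeight (p i) (S i t))
        * (φ (S j) * ψ (S j.rev))
      = bernoulliMean (p j) φ * bernoulliMean (p j.rev) ψ := by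
  have key : ∀ (F : (Fin (k 0) → Bool) → (Fin (k 1) → Bool) → ℝ),
      ∑ S : ∀ i : Fin 2, Fin (k i) → Bool, (∏ i, ∏ t, bernoulliWeight (p i) (S i t))
        * F (S 0) (S 1)
      = ∑ A, ∑ B, (∏ t, bernoulliWeight (p 0) (A t)) * (∏ t, bernoulliWeight (p 1) (B t))
        * F A B := by
    intro F
    rw [← (piFinTwoEquiv fun i => Fin (k i) → Bool).symm.sum_comp, Fintype.sum_prod_type]
    simp only [Fin.prod_univ_two]
    rfl
  have hj : j = 0 ∨ j = 1 := by omega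
  rcases hj with rfl | rfl
  · have := key fun A B => φ A * ψ B
    refine this.trans ?_
    rw [bernoulliMean, bernoulliMean, Finset.sum_mul_sum]
    refine Finset.sum_congr rfl fun A _ => Finset.sum_congr rfl fun B _ => ?_
    show _ = _ * ((∏ t, bernoulliWeight (p 1) (B t)) * _)
    ring
  · have := key fun A B => φ B * ψ A
    refine this.trans ?_
    rw [bernoulliMean, bernoulliMean, Finset.sum_mul_sum, Finset.sum_comm]
    refine Finset.sum_congr rfl fun A _ => Finset.sum_congr rfl fun B _ => ?_
    show _ = _ * ((∏ t, bernoulliWeight (p 0) (B t)) * _)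
    ring

end BernoulliMean

/-! ### Outer bound. -/

section Converse

/-- The number of positions selected by `A`. -/
noncomputable def count {n : ℕ} (A : Fin n → Bool) : ℝ := ∑ t, if A t then 1 else 0

lemma count_not {n : ℕ} (A : Fin n → Bool) : count (fun t => !A t) = n - count A := by
  unfold count
  rw [eq_sub_iff_add_eq, ← Finset.sum_add_distrib]
  have : ∀ t, ((if (!A t) = true then (1 : ℝ) else 0) + if A t = true then 1 else 0) = 1 := by
    intro t; cases A t <;> simp
  rw [Finset.sum_congr rfl fun t _ => this t]
  simp

lemma mask_eq_mask_iff {n : ℕ} (A : Fin n → Bool) (x y : Fin n → ZMod 2) :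
    mask A x = mask A y ↔ ∀ t, A t = true → x t = y t := by
  refine ⟨fun h t ht => ?_, fun h => funext fun t => ?_⟩
  · simpa [mask, ht] using congrFun h t
  · unfold mask
    split_ifs with ht
    · exact h t ht
    · rfl

lemma entropy_mask_le {Ω : Type*} [Fintype Ω] {n : ℕ} (A : Fin n → Bool)
    (X : Ω → Fin n → ZMod 2) : entropy (fun ω => mask A (X ω)) ≤ count A * Real.log 2 := by
  have h1 : entropy (fun ω => mask A (X ω))
      ≤ entropy (fun ω => (fun t : {t // A t = true} => X ω t)) := by
    refine entropy_mono fun ω ω' h => (mask_eq_mask_iff A _ _).2 fun t ht => ?_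
    exact congrFun h ⟨t, ht⟩
  refine h1.trans ((entropy_le_log_card _).trans_eq ?_)
  simp only [Fintype.card_fun, ZMod.card, Nat.cast_pow, Real.log_pow, Nat.cast_ofNat, count]
  rw [Fintype.card_subtype]
  simp

lemma entropy_string_le {Ω : Type*} [Fintype Ω] {n : ℕ} (X : Ω → Fin n → ZMod 2) :
    entropy X ≤ n * Real.log 2 := by
  refine (entropy_le_log_card _).trans_eq ?_
  simp

variable {T : Set (Fin 2)} {m : Fin 2 → ℕ} {n : ℕ}

lemma messages_ext {W W' : Messages m} (j : Fin 2) (h : W j = W' j) (h' : W j.rev = W' j.rev) :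
    W = W' := by
  have hj : j = 0 ∨ j = 1 := by omega
  funext i
  have hi : i = j ∨ i = j.rev := by
    rcases hj with rfl | rfl <;> revert i <;> decide
  rcases hi with rfl | rfl
  · exact h
  · exact h'

lemma log_card_messages (j : Fin 2) :
    Real.log (Fintype.card (Messages m)) = (m j + m j.rev) * Real.log 2 := by
  have hj : j = 0 ∨ j = 1 := by omega
  have h : Real.log (Fintype.card (Messages m)) = (m 0 + m 1) * Real.log 2 := by
    simp only [Fintype.card_pi, ZMod.card, Finset.prod_const, Finset.card_univ, Fintype.card_fin,
      Fin.prod_univ_two, ← pow_add]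
    push_cast
    rw [Real.log_pow]
    push_cast
    ring
  rw [h]
  rcases hj with rfl | rfl
  · rfl
  · rw [add_comm]; rfl

/-- The fraction of message pairs decoded wrongly by receiver `i`. -/
noncomputable def failFraction (c : Code T m n) (i : Fin 2) (E : CacheIndex m)
    (S : ChannelState n) : ℝ :=
  (Fintype.card (Messages m) : ℝ)⁻¹ * ∑ W : Messages m, if c.estimate i W E S ≠ W i then 1 else 0

/-- Probability of a pair of independent Bernoulli strings. -/
noncomputable def pairWeight (p : Fin 2 → ℝ) {k : Fin 2 → ℕ} (S : ∀ i, Fin (k i) → Bool) : ℝ :=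
  ∏ i, ∏ t, bernoulliWeight (p i) (S i t)

lemma pairWeight_nonneg {p : Fin 2 → ℝ} (hp : ∀ i, 0 ≤ p i ∧ p i ≤ 1) {k : Fin 2 → ℕ}
    (S : ∀ i, Fin (k i) → Bool) : 0 ≤ pairWeight p S :=
  Finset.prod_nonneg fun i _ => Finset.prod_nonneg fun _ _ => bernoulliWeight_nonneg (hp i) _

lemma sum_pairWeight_left (p : Fin 2 → ℝ) (k : Fin 2 → ℕ) (j : Fin 2)
    (φ : (Fin (k j) → Bool) → ℝ) :
    ∑ S : ∀ i, Fin (k i) → Bool, pairWeight p S * φ (S j) = bernoulliMean (p j) φ := by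
  have := sum_pair_bernoulli p k j φ fun _ => 1
  simpa [bernoulliMean_const, pairWeight] using this

lemma sum_pairWeight_right (p : Fin 2 → ℝ) (k : Fin 2 → ℕ) (j : Fin 2)
    (φ : (Fin (k j.rev) → Bool) → ℝ) :
    ∑ S : ∀ i, Fin (k i) → Bool, pairWeight p S * φ (S j.rev) = bernoulliMean (p j.rev) φ := by
  have := sum_pair_bernoulli p k j (fun _ => 1) φ
  simpa [bernoulliMean_const, pairWeight] using this

lemma sum_pairWeight (p : Fin 2 → ℝ) (k : Fin 2 → ℕ) :
    ∑ S : ∀ i, Fin (k i) → Bool, pairWeight p S = 1 := by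
  have := sum_pairWeight_left p k 0 fun _ => 1
  simpa [bernoulliMean_const] using this

/-- With `E` and `S` fixed only the uniform messages remain random, so entropy on a uniform space
suffices for the converse, and the code averages can be taken inside the sums. -/
lemma errorProb_eq (δ ε : Fin 2 → ℝ) (c : Code T m n) (i : Fin 2) :
    errorProb δ ε c i = ∑ E : CacheIndex m, pairWeight (fun i => 1 - ε i) E
      * ∑ S : ChannelState n, pairWeight (fun i => 1 - δ i) (k := fun _ => n) S
        * failFraction c i E S := by
  unfold errorProb
  rw [Finset.sum_comm]
  refine Finset.sum_congr rfl fun E _ => ?_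
  rw [Finset.sum_comm, Finset.mul_sum]
  refine Finset.sum_congr rfl fun S _ => ?_
  unfold failFraction
  simp only [Finset.mul_sum]
  refine Finset.sum_congr rfl fun W _ => ?_
  by_cases h : c.estimate i W E S ≠ W i
  · rw [if_pos h, if_pos h]
    unfold weight pairWeight
    ring
  · rw [if_neg h, if_neg h]
    ring

/-- Given the cache indices, the entropy of the received symbols at positions `A`, given message
`j` and the cached bits of the other message at receiver `j`. -/
noncomputable def outputEntropy (c : Code T m n) (j : Fin 2) (E : CacheIndex m)
    (A : Fin n → Bool) : ℝ :=
  entropy (fun W : Messages m => (mask A (c.input W E), W j, mask (E j) (W j.rev)))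
    - entropy (fun W : Messages m => (W j, mask (E j) (W j.rev)))

lemma outputEntropy_mono (c : Code T m n) (j : Fin 2) (E : CacheIndex m) :
    Monotone (outputEntropy c j E) := by
  intro A B hAB
  refine sub_le_sub_right (entropy_mono fun W W' h => ?_) _
  simp only [Prod.mk.injEq, mask_eq_mask_iff] at h ⊢
  exact ⟨fun t ht => h.1 t (hAB t ht), h.2⟩

lemma outputEntropy_bot (c : Code T m n) (j : Fin 2) (E : CacheIndex m) :
    0 ≤ outputEntropy c j E ⊥ := by
  refine sub_nonneg.2 (entropy_mono fun W W' h => ?_)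
  simp only [Prod.mk.injEq] at h ⊢
  exact h.2

/-- The outputs on `A` and on `B` each determine those on `A ⊓ B`, and together those on `A ⊔ B`;
the conditioning variables are common to all. -/
lemma outputEntropy_submodular (c : Code T m n) (j : Fin 2) (E : CacheIndex m)
    (A B : Fin n → Bool) :
    outputEntropy c j E (A ⊔ B) + outputEntropy c j E (A ⊓ B)
      ≤ outputEntropy c j E A + outputEntropy c j E B := by
  have := entropy_submodular
    (j := fun W : Messages m => (mask (A ⊔ B) (c.input W E), W j, mask (E j) (W j.rev)))
    (k := fun W : Messages m => (mask (A ⊓ B) (c.input W E), W j, mask (E j) (W j.rev)))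
    (u := fun W : Messages m => (mask A (c.input W E), W j, mask (E j) (W j.rev)))
    (v := fun W : Messages m => (mask B (c.input W E), W j, mask (E j) (W j.rev)))
    ?_ ?_ ?_
  · unfold outputEntropy
    linarith
  · intro W W' h
    simp only [Prod.mk.injEq, mask_eq_mask_iff] at h ⊢
    refine ⟨fun t ht => h.1 t ?_, h.2⟩
    simp only [Pi.inf_apply] at ht
    revert ht; cases A t <;> simp
  · intro W W' h
    simp only [Prod.mk.injEq, mask_eq_mask_iff] at h ⊢
    refine ⟨fun t ht => h.1 t ?_, h.2⟩
    simp only [Pi.inf_apply] at ht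
    revert ht; cases B t <;> simp
  · intro W W' h
    simp only [Prod.mk.injEq, mask_eq_mask_iff] at h ⊢
    refine ⟨fun t ht => ?_, h.1.2⟩
    by_cases hA : A t = true
    · exact h.1.1 t hA
    · refine h.2.1 t ?_
      simp only [Pi.sup_apply] at ht
      revert ht hA; cases A t <;> simp

/-- Receiver `j` recovers message `j` from its outputs and cache, so adjoining that message costs
only the Fano term. Outputs and cache carry at most one bit per received or cached position; the
cached bits cancel against the conditioning. -/
lemma outputEntropy_le (c : Code T m n) (j : Fin 2) (E : CacheIndex m) (S : ChannelState n) :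
    outputEntropy c j E (S j)
      ≤ (count (S j) - m j + 1 + failFraction c j E S * m j) * Real.log 2 := by
  have hfano := fano (Ω := Messages m) (f := fun W => W j) (est := fun W => c.estimate j W E S)
    (g := fun W => (mask (S j) (c.input W E), mask (E j) (W j.rev))) (by
      intro W W' h
      simp only [Prod.mk.injEq] at h
      simp only [Code.estimate, h.1, h.2])
  have hcard : Real.log (Fintype.card (Fin (m j) → ZMod 2)) = m j * Real.log 2 := by simp
  rw [hcard] at hfano
  have h1 : entropy (fun W : Messages m => (mask (S j) (c.input W E), W j, mask (E j) (W j.rev)))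
      ≤ entropy (fun W : Messages m =>
        (W j, mask (S j) (c.input W E), mask (E j) (W j.rev))) := by
    refine entropy_mono fun W W' h => ?_
    simp only [Prod.mk.injEq] at h ⊢
    tauto
  have h2 : entropy (fun W : Messages m => (mask (S j) (c.input W E), mask (E j) (W j.rev)))
      ≤ count (S j) * Real.log 2 + count (E j) * Real.log 2 :=
    (entropy_le_add fun _ _ h => h).trans
      (add_le_add (entropy_mask_le _ _) (entropy_mask_le _ _))
  -- All messages are recovered from the conditioning variables and the uncached bits, which bounds
  -- the subtracted entropy from below.
  have h3 : (m j + m j.rev) * Real.log 2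
      ≤ entropy (fun W : Messages m => (W j, mask (E j) (W j.rev)))
        + count (fun t => !E j t) * Real.log 2 := by
    rw [← log_card_messages, ← entropy_of_injective (f := fun W : Messages m => W) fun _ _ h => h]
    refine (entropy_le_add (v := fun W : Messages m => mask (fun t => !E j t) (W j.rev))
      ?_).trans (add_le_add_right (entropy_mask_le _ _) _)
    intro W W' h
    simp only [Prod.mk.injEq, mask_eq_mask_iff] at h
    refine messages_ext j h.1.1 (funext fun t => ?_)
    cases ht : E j t
    · exact h.2 t (by simp [ht])
    · exact h.1.2 t ht
  rw [count_not] at h3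
  unfold outputEntropy failFraction
  linarith

/-- The cache of the other receiver is a function of message `j`, so its decoder runs on the
variables of `outputEntropy`. Up to the Fano term these then determine all messages, so the outputs
must supply the bits not cached at receiver `j`. -/
lemma le_outputEntropy (c : Code T m n) (j : Fin 2) (E : CacheIndex m) (S : ChannelState n) :
    (m j.rev - count (E j) - 1 - failFraction c j.rev E S * m j.rev) * Real.log 2
      ≤ outputEntropy c j E (S j.rev) := by
  -- `W j` and `W j.rev.rev` have different types; abstracting the index avoids a cast.
  have hrev : ∀ i, j = i → ∀ W W' : Messages m, W j = W' j → W i = W' i := by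
    rintro _ rfl W W' h; exact h
  have hfano := fano (Ω := Messages m) (f := fun W => W j.rev)
    (est := fun W => c.estimate j.rev W E S)
    (g := fun W => (mask (S j.rev) (c.input W E), W j, mask (E j) (W j.rev))) (by
      intro W W' h
      simp only [Prod.mk.injEq] at h
      simp only [Code.estimate, h.1, hrev _ (Fin.rev_rev j).symm W W' h.2.1])
  have hcard : Real.log (Fintype.card (Fin (m j.rev) → ZMod 2)) = m j.rev * Real.log 2 := by simp
  rw [hcard] at hfano
  have h1 : (m j + m j.rev) * Real.log 2 ≤ entropy (fun W : Messages m =>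
      (W j.rev, mask (S j.rev) (c.input W E), W j, mask (E j) (W j.rev))) := by
    rw [← log_card_messages, ← entropy_of_injective (f := fun W : Messages m => W) fun _ _ h => h]
    refine entropy_mono fun W W' h => ?_
    simp only [Prod.mk.injEq] at h
    exact messages_ext j h.2.2.1 h.1
  have h2 : entropy (fun W : Messages m => (W j, mask (E j) (W j.rev)))
      ≤ m j * Real.log 2 + count (E j) * Real.log 2 :=
    (entropy_le_add fun _ _ h => h).trans
      (add_le_add (entropy_string_le _) (entropy_mask_le _ _))
  unfold outputEntropy failFraction
  linarith

/-- Monotonicity covers `q ≤ p` and the linear growth bound covers `p ≤ q`; the minimum merges the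
two cases. -/
lemma min_mul_bernoulliMean_le (c : Code T m n) (j : Fin 2) (E : CacheIndex m) {p q : ℝ}
    (hp : 0 < p ∧ p ≤ 1) (hq : 0 < q ∧ q ≤ 1) :
    min (p / q) 1 * bernoulliMean q (outputEntropy c j E)
      ≤ bernoulliMean p (outputEntropy c j E) := by
  rcases le_total q p with h | h
  · rw [min_eq_right ((one_le_div hq.1).2 h), one_mul]
    exact bernoulliMean_mono_param hq.1.le h hp.2 (outputEntropy_mono c j E)
  · rw [min_eq_left ((div_le_one hq.1).2 h), div_mul_eq_mul_div, div_le_iff₀ hq.1,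
      mul_comm _ q]
    exact bernoulliMean_ratio hp.1.le h hq.2 (outputEntropy_bot c j E)
      (outputEntropy_submodular c j E)

/-- The outer bound at finite block length. -/
lemma converse_bound {δ ε : Fin 2 → ℝ} (hδ : ∀ i, 0 ≤ δ i ∧ δ i < 1)
    (hε : ∀ i, 0 ≤ ε i ∧ ε i ≤ 1) (c : Code T m n) (j : Fin 2) :
    min ((1 - δ j) / (1 - δ j.rev)) 1
        * (m j.rev * ε j - 1 - errorProb δ ε c j.rev * m j.rev)
      ≤ n * (1 - δ j) - m j + 1 + errorProb δ ε c j * m j := by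
  have hlog : 0 < Real.log 2 := Real.log_pos one_lt_two
  have hp : ∀ i, 0 < 1 - δ i ∧ 1 - δ i ≤ 1 := fun i =>
    ⟨by linarith [(hδ i).2], by linarith [(hδ i).1]⟩
  have hq : ∀ i, 0 ≤ 1 - ε i ∧ 1 - ε i ≤ 1 := fun i =>
    ⟨by linarith [(hε i).2], by linarith [(hε i).1]⟩
  set p : Fin 2 → ℝ := fun i => 1 - δ i with hpdef
  set q : Fin 2 → ℝ := fun i => 1 - ε i with hqdef
  have hE0 : ∀ E : CacheIndex m, 0 ≤ pairWeight q E := fun E => pairWeight_nonneg hq E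
  have hS0 : ∀ S : ChannelState n, 0 ≤ pairWeight p (k := fun _ => n) S :=
    fun S => pairWeight_nonneg (fun i => ⟨(hp i).1.le, (hp i).2⟩) S
  have hS1 := sum_pairWeight p fun _ => n
  have hE1 : ∑ E : CacheIndex m, pairWeight q E = 1 := sum_pairWeight q fun i => m i.rev
  have hScount := sum_pairWeight_left p (fun _ => n) j count
  have hEcount : ∑ E : CacheIndex m, pairWeight q E * count (E j) = _ :=
    sum_pairWeight_left q (fun i => m i.rev) j count
  have hcount : ∀ (k : ℕ) (r : ℝ), bernoulliMean (n := k) r count = k * r :=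
    fun k r => bernoulliMean_count
  rw [hcount] at hScount hEcount
  have hA : ∑ E : CacheIndex m, pairWeight q E * bernoulliMean (p j) (outputEntropy c j E)
      ≤ (n * p j - m j + 1 + errorProb δ ε c j * m j) * Real.log 2 := by
    calc _ ≤ ∑ E : CacheIndex m, pairWeight q E * ((n * p j - m j + 1
          + (∑ S : ChannelState n, pairWeight p (k := fun _ => n) S * failFraction c j E S)
            * m j) * Real.log 2) := by
          refine Finset.sum_le_sum fun E _ => mul_le_mul_of_nonneg_left ?_ (hE0 E)
          rw [← sum_pairWeight_left p (fun _ => n) j (outputEntropy c j E)]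
          refine (Finset.sum_le_sum fun S _ => mul_le_mul_of_nonneg_left
            (outputEntropy_le c j E S) (hS0 S)).trans_eq ?_
          rw [← hScount]
          have : ∀ S : ChannelState n, pairWeight p (k := fun _ => n) S
              * ((count (S j) - m j + 1 + failFraction c j E S * m j) * Real.log 2)
              = (pairWeight p (k := fun _ => n) S * count (S j)
                + pairWeight p (k := fun _ => n) S * (1 - m j)
                + pairWeight p (k := fun _ => n) S * failFraction c j E S * m j)
                * Real.log 2 := fun S => by ring
          simp_rw [this, ← Finset.sum_mul, Finset.sum_add_distrib, ← Finset.sum_mul]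
          rw [hS1]
          ring
      _ = _ := by
          rw [errorProb_eq]
          have : ∀ E : CacheIndex m, pairWeight q E * ((n * p j - m j + 1
            + (∑ S : ChannelState n, pairWeight p (k := fun _ => n) S * failFraction c j E S)
              * m j) * Real.log 2)
            = (pairWeight q E * (n * p j - m j + 1)
              + pairWeight q E * (∑ S : ChannelState n,
                pairWeight p (k := fun _ => n) S * failFraction c j E S) * m j) * Real.log 2 :=
            fun E => by ring
          simp_rw [this, ← Finset.sum_mul, Finset.sum_add_distrib, ← Finset.sum_mul]
          rw [hE1]
          ring
  have hB : (m j.rev * ε j - 1 - errorProb δ ε c j.rev * m j.rev) * Real.log 2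
      ≤ ∑ E : CacheIndex m, pairWeight q E
        * bernoulliMean (p j.rev) (outputEntropy c j E) := by
    calc _ = ∑ E : CacheIndex m, pairWeight q E * ((m j.rev - count (E j) - 1
          - (∑ S : ChannelState n, pairWeight p (k := fun _ => n) S * failFraction c j.rev E S)
            * m j.rev) * Real.log 2) := by
          rw [errorProb_eq]
          have : ∀ E : CacheIndex m, pairWeight q E * ((m j.rev - count (E j) - 1
            - (∑ S : ChannelState n, pairWeight p (k := fun _ => n) S
              * failFraction c j.rev E S) * m j.rev) * Real.log 2)
            = (pairWeight q E * (m j.rev - 1) - pairWeight q E * count (E j)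
              - pairWeight q E * (∑ S : ChannelState n,
                pairWeight p (k := fun _ => n) S * failFraction c j.rev E S) * m j.rev)
              * Real.log 2 :=
            fun E => by ring
          simp_rw [this, ← Finset.sum_mul, Finset.sum_sub_distrib, ← Finset.sum_mul]
          rw [hE1, hEcount]
          simp only [hqdef]
          ring
      _ ≤ _ := by
          refine Finset.sum_le_sum fun E _ => mul_le_mul_of_nonneg_left ?_ (hE0 E)
          rw [← sum_pairWeight_right p (fun _ => n) j (outputEntropy c j E)]
          refine Eq.trans_le ?_ (Finset.sum_le_sum fun S _ => mul_le_mul_of_nonneg_left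
            (le_outputEntropy c j E S) (hS0 S))
          have : ∀ S : ChannelState n, pairWeight p (k := fun _ => n) S
              * ((m j.rev - count (E j) - 1 - failFraction c j.rev E S * m j.rev) * Real.log 2)
              = (pairWeight p (k := fun _ => n) S * (m j.rev - count (E j) - 1)
                - pairWeight p (k := fun _ => n) S * failFraction c j.rev E S * m j.rev)
                * Real.log 2 := fun S => by ring
          simp_rw [this, ← Finset.sum_mul, Finset.sum_sub_distrib, ← Finset.sum_mul]
          rw [hS1]
          ring
  have hC : min (p j / p j.rev) 1 * ∑ E : CacheIndex m, pairWeight q E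
        * bernoulliMean (p j.rev) (outputEntropy c j E)
      ≤ ∑ E : CacheIndex m, pairWeight q E * bernoulliMean (p j) (outputEntropy c j E) := by
    rw [Finset.mul_sum]
    refine Finset.sum_le_sum fun E _ => ?_
    rw [mul_left_comm]
    exact mul_le_mul_of_nonneg_left (min_mul_bernoulliMean_le c j E (hp j) (hp j.rev)) (hE0 E)
  have hκ : 0 ≤ min (p j / p j.rev) 1 :=
    le_min (div_nonneg (hp j).1.le (hp j.rev).1.le) zero_le_one
  have hfin := ((mul_le_mul_of_nonneg_left hB hκ).trans hC).trans hA
  rw [← mul_assoc] at hfin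
  exact le_of_mul_le_mul_right hfin hlog

lemma tendsto_floor_mul_div {R : ℝ} (hR : 0 ≤ R) :
    Tendsto (fun n : ℕ => (⌊(n : ℝ) * R⌋₊ : ℝ) / n) atTop (𝓝 R) := by
  have := (tendsto_nat_floor_mul_div_atTop hR).comp (tendsto_natCast_atTop_atTop (R := ℝ))
  refine this.congr fun n => ?_
  simp [mul_comm]

/-- The finite-length bound is divided by the block length, after which the Fano constants and the
error terms vanish in the limit. -/
lemma achievable_bound {δ ε R : Fin 2 → ℝ} (hδ : ∀ i, 0 ≤ δ i ∧ δ i < 1)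
    (hε : ∀ i, 0 ≤ ε i ∧ ε i ≤ 1) (hR : Achievable T δ ε R) (j : Fin 2) :
    ε j * min ((1 - δ j) / (1 - δ j.rev)) 1 * R j.rev + R j ≤ 1 - δ j := by
  obtain ⟨hR0, c, hc⟩ := hR
  have hm := fun i => tendsto_floor_mul_div (hR0 i)
  have hinv := tendsto_inv_atTop_nhds_zero_nat (𝕜 := ℝ)
  have hl : Tendsto (fun n : ℕ => min ((1 - δ j) / (1 - δ j.rev)) 1
      * ((⌊(n : ℝ) * R j.rev⌋₊ : ℝ) / n * ε j - (n : ℝ)⁻¹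
        - errorProb δ ε (c n) j.rev * ((⌊(n : ℝ) * R j.rev⌋₊ : ℝ) / n))) atTop
      (𝓝 (min ((1 - δ j) / (1 - δ j.rev)) 1 * (R j.rev * ε j - 0 - 0 * R j.rev))) :=
    ((((hm j.rev).mul_const _).sub hinv).sub ((hc j.rev).mul (hm j.rev))).const_mul _
  have hr : Tendsto (fun n : ℕ => (1 - δ j) - (⌊(n : ℝ) * R j⌋₊ : ℝ) / n + (n : ℝ)⁻¹
        + errorProb δ ε (c n) j * ((⌊(n : ℝ) * R j⌋₊ : ℝ) / n)) atTop
      (𝓝 ((1 - δ j) - R j + 0 + 0 * R j)) :=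
    (((hm j).const_sub _).add hinv).add ((hc j).mul (hm j))
  have := le_of_tendsto_of_tendsto hl hr ?_
  · linarith
  · filter_upwards [eventually_gt_atTop 0] with n hn
    have hn' : (0 : ℝ) < n := by exact_mod_cast hn
    have hb := mul_le_mul_of_nonneg_left (converse_bound hδ hε (c n) j) (inv_pos.2 hn').le
    have hnn : (n : ℝ)⁻¹ * n = 1 := inv_mul_cancel₀ hn'.ne'
    simp only [div_eq_mul_inv] at hb ⊢
    linear_combination hb + (1 - δ j) * hnn

lemma isClosed_polytope (δ ε : Fin 2 → ℝ) : IsClosed (polytope δ ε) := by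
  unfold polytope
  simp only [Set.ofPred_and, Set.ofPred_forall]
  refine (isClosed_iInter fun i => isClosed_le continuous_const (by fun_prop)).inter
    (isClosed_iInter fun i => isClosed_le (by fun_prop) continuous_const)

theorem capacityRegion_subset_polytope {δ ε : Fin 2 → ℝ} (hδ : ∀ i, 0 ≤ δ i ∧ δ i < 1)
    (hε : ∀ i, 0 ≤ ε i ∧ ε i ≤ 1) : capacityRegion T δ ε ⊆ polytope δ ε := by
  refine closure_minimal (fun R hR => ⟨hR.1, fun i => ?_⟩) (isClosed_polytope δ ε)
  have := achievable_bound hδ hε hR i.rev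
  rwa [Fin.rev_rev] at this

end Converse

/-! ### Uniformly random binary matrices and the union bound. -/

section RandomCode

variable {K : Type*} [Fintype K] [DecidableEq K] {n : ℕ}

/-- Flipping a coordinate of `g` at which `d` is 1 exchanges orthogonal and non-orthogonal vectors.
-/
lemma two_mul_sum_orthogonal {d : K → ZMod 2} (hd : d ≠ 0) :
    2 * ∑ g : K → ZMod 2, (if ∑ k, g k * d k = 0 then (1 : ℝ) else 0)
      = Fintype.card (K → ZMod 2) := by
  obtain ⟨k₀, hk₀⟩ := Function.ne_iff.1 hd
  have hd1 : d k₀ = 1 := by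
    have : ∀ x : ZMod 2, x ≠ 0 → x = 1 := by decide
    exact this _ hk₀
  have hshift : ∑ g : K → ZMod 2, (if ∑ k, g k * d k = 0 then (1 : ℝ) else 0)
      = ∑ g : K → ZMod 2, (if ∑ k, g k * d k = 0 then (0 : ℝ) else 1) := by
    rw [← Equiv.sum_comp (Equiv.addRight (Pi.single k₀ (1 : ZMod 2)))]
    refine Finset.sum_congr rfl fun g _ => ?_
    have : ∑ k, (Equiv.addRight (Pi.single k₀ (1 : ZMod 2)) g) k * d k
        = ∑ k, g k * d k + 1 := by
      simp only [Equiv.coe_addRight, Pi.add_apply, add_mul, Finset.sum_add_distrib]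
      congr 1
      rw [Finset.sum_eq_single k₀]
      · simp [hd1]
      · intro k _ hk; simp [Pi.single_eq_of_ne hk]
      · simp
    rw [this]
    generalize ∑ k, g k * d k = x
    have h01 : x = 0 ∨ x = 1 := by revert x; decide
    rcases h01 with rfl | rfl
    · simp
    · rw [if_pos (by decide), if_neg (by decide)]
  rw [two_mul]
  nth_rewrite 2 [hshift]
  rw [← Finset.sum_add_distrib]
  have : ∀ g : K → ZMod 2, ((if ∑ k, g k * d k = 0 then (1 : ℝ) else 0)
      + if ∑ k, g k * d k = 0 then (0 : ℝ) else 1) = 1 := by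
    intro g; split_ifs <;> simp
  simp [this]

/-- A fixed nonzero vector is orthogonal to all the rows selected by `A`. -/
lemma sum_orthogonal_rows {d : K → ZMod 2} (hd : d ≠ 0) (A : Fin n → Bool) :
    ∑ G : Fin n → K → ZMod 2, (if ∀ t, A t = true → ∑ k, G t k * d k = 0 then (1 : ℝ) else 0)
      = Fintype.card (Fin n → K → ZMod 2) * ∏ t, if A t then (2 : ℝ)⁻¹ else 1 := by
  have h1 : ∀ G : Fin n → K → ZMod 2,
      (if ∀ t, A t = true → ∑ k, G t k * d k = 0 then (1 : ℝ) else 0)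
      = ∏ t, if A t = true → ∑ k, G t k * d k = 0 then (1 : ℝ) else 0 := by
    intro G
    rw [Finset.prod_boole]
    simp
  simp_rw [h1]
  refine (Fintype.prod_sum fun t (g : K → ZMod 2) =>
    if A t = true → ∑ k, g k * d k = 0 then (1 : ℝ) else 0).symm.trans ?_
  have h2 : (Fintype.card (Fin n → K → ZMod 2) : ℝ)
      = ∏ _t : Fin n, (Fintype.card (K → ZMod 2) : ℝ) := by
    rw [Fintype.card_pi]; push_cast; rfl
  rw [h2, ← Finset.prod_mul_distrib]
  refine Finset.prod_congr rfl fun t _ => ?_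
  cases A t
  · simp
  · simp only [forall_const, if_true]
    rw [← two_mul_sum_orthogonal hd]
    ring

/-- Some nonzero vector supported on `U` is orthogonal to all the rows of `G` selected by `A`. -/
def Confusable (G : Fin n → K → ZMod 2) (U : K → Bool) (A : Fin n → Bool) : Prop :=
  ∃ d : K → ZMod 2, d ≠ 0 ∧ (∀ k, U k = false → d k = 0) ∧
    ∀ t, A t = true → ∑ k, G t k * d k = 0

lemma card_supported (U : K → Bool) :
    ∑ d : K → ZMod 2, (if ∀ k, U k = false → d k = 0 then (1 : ℝ) else 0)
      = ∏ k, if U k then (2 : ℝ) else 1 := by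
  have h1 : ∀ d : K → ZMod 2, (if ∀ k, U k = false → d k = 0 then (1 : ℝ) else 0)
      = ∏ k, if U k = false → d k = 0 then (1 : ℝ) else 0 := by
    intro d
    rw [Finset.prod_boole]
    simp
  simp_rw [h1]
  rw [← Fintype.prod_sum fun k x => if U k = false → x = 0 then (1 : ℝ) else 0]
  refine Finset.prod_congr rfl fun k _ => ?_
  by_cases h : U k = true <;> simp [h]

open Classical in
-- Union bound: there are 2^|U| vectors supported on `U`, and each nonzero one is orthogonal to all
-- selected rows with probability 2^(-|A|).
lemma sum_confusable_le (U : K → Bool) (A : Fin n → Bool) :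
    ∑ G : Fin n → K → ZMod 2, (if Confusable G U A then (1 : ℝ) else 0)
      ≤ Fintype.card (Fin n → K → ZMod 2)
        * ((∏ k, if U k then (2 : ℝ) else 1) * ∏ t, if A t then (2 : ℝ)⁻¹ else 1) := by
  have hP : 0 ≤ (Fintype.card (Fin n → K → ZMod 2) : ℝ) * ∏ t, if A t then (2 : ℝ)⁻¹ else 1 :=
    mul_nonneg (by positivity) (Finset.prod_nonneg fun t _ => by split_ifs <;> norm_num)
  calc _ ≤ ∑ G : Fin n → K → ZMod 2, ∑ d : K → ZMod 2,
        (if ∀ k, U k = false → d k = 0 then (1 : ℝ) else 0)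
          * (if d ≠ 0 ∧ ∀ t, A t = true → ∑ k, G t k * d k = 0 then (1 : ℝ) else 0) := by
        refine Finset.sum_le_sum fun G _ => ?_
        have hnn : ∀ d : K → ZMod 2, 0 ≤ (if ∀ k, U k = false → d k = 0 then (1 : ℝ) else 0)
          * (if d ≠ 0 ∧ ∀ t, A t = true → ∑ k, G t k * d k = 0 then (1 : ℝ) else 0) :=
          fun d => mul_nonneg (by split_ifs <;> norm_num) (by split_ifs <;> norm_num)
        split_ifs with h
        · obtain ⟨d, hd, hU, hA⟩ := h
          refine le_trans ?_ (Finset.single_le_sum (fun d _ => hnn d) (Finset.mem_univ d))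
          rw [if_pos hU, if_pos ⟨hd, hA⟩, one_mul]
        · exact Finset.sum_nonneg fun d _ => hnn d
    _ = ∑ d : K → ZMod 2, (if ∀ k, U k = false → d k = 0 then (1 : ℝ) else 0)
          * ∑ G : Fin n → K → ZMod 2,
            (if d ≠ 0 ∧ ∀ t, A t = true → ∑ k, G t k * d k = 0 then (1 : ℝ) else 0) := by
        rw [Finset.sum_comm]
        simp_rw [Finset.mul_sum]
    _ ≤ ∑ d : K → ZMod 2, (if ∀ k, U k = false → d k = 0 then (1 : ℝ) else 0)
          * (Fintype.card (Fin n → K → ZMod 2) * ∏ t, if A t then (2 : ℝ)⁻¹ else 1) := by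
        refine Finset.sum_le_sum fun d _ => mul_le_mul_of_nonneg_left ?_
          (by split_ifs <;> norm_num)
        by_cases hd : d = 0
        · simpa [hd] using hP
        · rw [← sum_orthogonal_rows hd]
          simp [hd]
    _ = _ := by
        rw [← Finset.sum_mul]
        have := card_supported U
        rw [← this]
        -- The two sides differ only in the decidability instance.
        have : ∑ d : K → ZMod 2, (if ∀ k, U k = false → d k = 0 then (1 : ℝ) else 0)
          = ∑ d : K → ZMod 2, @ite ℝ (∀ k, U k = false → d k = 0)
            (Fintype.decidableForallFintype) 1 0 :=
          Finset.sum_congr rfl fun d _ => by congr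
        rw [this]
        ring

open Classical in
/-- The probability over a uniformly random matrix `G` that `G` is confusable. -/
lemma confusable_prob_le (U : K → Bool) (A : Fin n → Bool) {s : ℝ} (hs : 0 ≤ s)
    (hs2 : s ≤ Real.log 2) :
    ∑ G : Fin n → K → ZMod 2, (if Confusable G U A then (1 : ℝ) else 0)
      ≤ Fintype.card (Fin n → K → ZMod 2) * ((∏ k, if U k then Real.exp s else 1)
        * ∏ t, if A t then Real.exp (-s) else 1) := by
  have h1 := sum_confusable_le U A
  have h2 : ∑ G : Fin n → K → ZMod 2, (if Confusable G U A then (1 : ℝ) else 0)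
      ≤ Fintype.card (Fin n → K → ZMod 2) := by
    refine (Finset.sum_le_sum fun G _ => (show _ ≤ (1 : ℝ) by split_ifs <;> norm_num)).trans_eq ?_
    simp
  have hprod : ∀ (x : ℝ) (ι : Type _) [Fintype ι] (V : ι → Bool),
      (∏ k, if V k then Real.exp x else 1) = Real.exp (x * ∑ k, if V k then (1 : ℝ) else 0) := by
    intro x ι _ V
    rw [Finset.mul_sum, Real.exp_sum]
    refine Finset.prod_congr rfl fun k _ => ?_
    split_ifs <;> simp
  have e2 : Real.exp (Real.log 2) = 2 := Real.exp_log two_pos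
  have e2' : Real.exp (-Real.log 2) = 2⁻¹ := by rw [Real.exp_neg, e2]
  have hC : (0 : ℝ) ≤ Fintype.card (Fin n → K → ZMod 2) := by positivity
  have hU : (∏ k, if U k then (2 : ℝ) else 1)
      = Real.exp (Real.log 2 * ∑ k, if U k then (1 : ℝ) else 0) := by
    rw [← hprod, e2]
  have hA : (∏ t, if A t then (2 : ℝ)⁻¹ else 1)
      = Real.exp (-Real.log 2 * ∑ t, if A t then (1 : ℝ) else 0) := by
    rw [Finset.mul_sum, Real.exp_sum]
    refine Finset.prod_congr rfl fun k _ => ?_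
    split_ifs <;> simp [e2']
  have hA' : (∏ t, if A t then Real.exp (-s) else 1)
      = Real.exp (-s * ∑ t, if A t then (1 : ℝ) else 0) := by
    rw [Finset.mul_sum, Real.exp_sum]
    refine Finset.prod_congr rfl fun k _ => ?_
    split_ifs <;> simp
  rw [hU, hA, ← Real.exp_add] at h1
  rw [hprod, hA', ← Real.exp_add]
  set u := ∑ k, if U k then (1 : ℝ) else 0
  set a := ∑ t, if A t then (1 : ℝ) else 0
  -- With u = |U| and a = |A|, this is min(1, 2^(u-a)) ≤ e^(s(u-a)). The right side is a product
  -- over positions, so its mean over erasures and caches can be computed factor by factor.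
  rcases le_total a u with h | h
  · refine h2.trans (le_mul_of_one_le_right hC (Real.one_le_exp ?_))
    nlinarith
  · refine h1.trans (mul_le_mul_of_nonneg_left (Real.exp_le_exp.2 ?_) hC)
    nlinarith

end RandomCode

/-! ### Exponential moments of Bernoulli counts. -/

section Chernoff

variable {n : ℕ} {p : ℝ}

lemma exp_le_one_add_add_sq {x : ℝ} (hx : |x| ≤ 1) : Real.exp x ≤ 1 + (x + x ^ 2) := by
  have := (abs_le.1 (Real.abs_exp_sub_one_sub_id_le hx)).2
  linarith

lemma bernoulliMean_exp_le (hp : 0 ≤ p ∧ p ≤ 1) {x : ℝ} (hx : |x| ≤ 1) (r : Fin n → Bool) :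
    bernoulliMean p (fun A => ∏ t, if (A t && r t) = true then Real.exp x else 1)
      ≤ Real.exp (p * (x + x ^ 2) * ∑ t, if r t then 1 else 0) := by
  rw [bernoulliMean_prod fun t b => if (b && r t) = true then Real.exp x else 1, Finset.mul_sum,
    Real.exp_sum]
  refine Finset.prod_le_prod (fun t _ => ?_) fun t _ => ?_
  · have := Real.exp_pos x
    refine add_nonneg (mul_nonneg hp.1 ?_) (mul_nonneg (by linarith [hp.2]) ?_) <;>
      split_ifs <;> positivity
  · cases r t
    · simp
    · simp only [Bool.and_true, if_true, Bool.false_eq_true, if_false, mul_one]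
      have h1 := mul_le_mul_of_nonneg_left (exp_le_one_add_add_sq hx) hp.1
      have h2 := Real.add_one_le_exp (p * (x + x ^ 2))
      linarith

lemma bernoulliMean_exp_not_le (hp : 0 ≤ p ∧ p ≤ 1) {x : ℝ} (hx : |x| ≤ 1) :
    bernoulliMean p (fun A : Fin n → Bool => ∏ t, if (!A t) = true then Real.exp x else 1)
      ≤ Real.exp ((1 - p) * (x + x ^ 2) * n) := by
  rw [bernoulliMean_prod fun t b => if (!b) = true then Real.exp x else 1, mul_comm _ (n : ℝ),
    Real.exp_nat_mul]
  simp only [Bool.not_true, Bool.false_eq_true, if_false, Bool.not_false, if_true, mul_one,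
    Finset.prod_const, Finset.card_univ, Fintype.card_fin]
  have h1 := mul_le_mul_of_nonneg_left (exp_le_one_add_add_sq hx) (sub_nonneg.2 hp.2)
  have h2 := Real.add_one_le_exp ((1 - p) * (x + x ^ 2))
  refine pow_le_pow_left₀ ?_ (by linarith) n
  have := mul_nonneg (sub_nonneg.2 hp.2) (Real.exp_pos x).le
  linarith [hp.1]

end Chernoff

/-! ### The two-phase linear code and its error events. -/

section Scheme

variable {m : Fin 2 → ℕ} {n : ℕ}

open Classical in
/-- The code with the given encoder whose receivers output any message consistent with their
observations. -/
noncomputable def consistentCode {T : Set (Fin 2)}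
    (enc : Messages m → CacheIndexOf T m → Fin n → ZMod 2) : Code T m n where
  enc := enc
  dec i Y S cache Eown ETx :=
    if h : ∃ W : Messages m, mask S (enc W ETx) = Y ∧ mask Eown (W i.rev) = cache
    then h.choose i else 0

lemma consistentCode_error {T : Set (Fin 2)}
    {enc : Messages m → CacheIndexOf T m → Fin n → ZMod 2} {i : Fin 2} {W : Messages m}
    {E : CacheIndex m} {S : ChannelState n}
    (h : (consistentCode enc).estimate i W E S ≠ W i) :
    ∃ W' : Messages m, W' i ≠ W i ∧
      (∀ t, S i t = true → enc W' (fun j => E j) t = enc W (fun j => E j) t) ∧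
      ∀ t, E i t = true → W' i.rev t = W i.rev t := by
  have hex : ∃ W' : Messages m, mask (S i) (enc W' fun j => E j) = mask (S i) (enc W fun j => E j)
      ∧ mask (E i) (W' i.rev) = mask (E i) (W i.rev) := ⟨W, rfl, rfl⟩
  have heq : (consistentCode enc).estimate i W E S = hex.choose i := dif_pos hex
  rw [heq] at h
  exact ⟨hex.choose, h, (mask_eq_mask_iff _ _ _).1 hex.choose_spec.1,
    (mask_eq_mask_iff _ _ _).1 hex.choose_spec.2⟩

/-- The positions of the message bits: those of receiver `w.rev`, then those of receiver `w`. -/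
abbrev BitPos (m : Fin 2 → ℕ) (w : Fin 2) : Type := Fin (m w.rev) ⊕ Fin (m w.rev.rev)

/-- The message bits combined at a given time. In the first phase these are the bits for receiver
`w.rev` that receiver `w` has not cached, in the second phase all the other bits. -/
def activeBits (w : Fin 2) (first : Bool) (e : Fin (m w.rev) → Bool) (W : Messages m) :
    BitPos m w → ZMod 2 :=
  if first then Sum.elim (mask (fun ℓ => !e ℓ) (W w.rev)) 0
  else Sum.elim (mask e (W w.rev)) (W w.rev.rev)

/-- The two-phase linear encoder. -/
def twoPhaseEnc (w : Fin 2) (first : Fin n → Bool) (G : Fin n → BitPos m w → ZMod 2)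
    (W : Messages m) (E : CacheIndexOf {w} m) (t : Fin n) : ZMod 2 :=
  ∑ k, G t k * activeBits w (first t) (E ⟨w, Set.mem_singleton w⟩) W k

lemma activeBits_sub (w : Fin 2) (first : Bool) (e : Fin (m w.rev) → Bool) (W W' : Messages m)
    (k : BitPos m w) :
    activeBits w first e (W' - W) k = activeBits w first e W' k - activeBits w first e W k := by
  unfold activeBits
  cases first <;> cases k
  · simp only [Bool.false_eq_true, if_false, Sum.elim_inl, mask]
    split_ifs <;> simp
  · simp
  · simp only [if_true, Sum.elim_inl, mask]
    split_ifs <;> simp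
  · simp

lemma sum_activeBits_sub_eq_zero {w : Fin 2} {first : Fin n → Bool}
    {G : Fin n → BitPos m w → ZMod 2} {W W' : Messages m} {E : CacheIndex m} {t : Fin n}
    (h : twoPhaseEnc w first G W' (fun j => E j) t = twoPhaseEnc w first G W (fun j => E j) t) :
    ∑ k, G t k * activeBits w (first t) (E w) (W' - W) k = 0 := by
  simp_rw [activeBits_sub, mul_sub, Finset.sum_sub_distrib]
  exact sub_eq_zero.2 h

/-- The confusing vector is the difference of the two candidates in phase two. They agree on the
bits cached at `w`, so only message `w` contributes, and there they differ. -/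
lemma weak_confusable {w : Fin 2} {first : Fin n → Bool} {G : Fin n → BitPos m w → ZMod 2}
    {W : Messages m} {E : CacheIndex m} {S : ChannelState n}
    (h : (consistentCode (twoPhaseEnc w first G)).estimate w W E S ≠ W w) :
    Confusable G (Sum.elim (fun _ => false) fun _ => true) (fun t => S w t && !first t) := by
  obtain ⟨W', hne, hX, hE⟩ := consistentCode_error h
  have hrev : ∀ i, w = i → (W' - W) i ≠ 0 := by
    rintro _ rfl; exact sub_ne_zero.2 hne
  have hmask : mask (E w) ((W' - W) w.rev) = 0 := by
    funext ℓ
    unfold mask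
    split_ifs with hℓ
    · simp [hE ℓ hℓ]
    · rfl
  refine ⟨activeBits w false (E w) (W' - W), fun h0 => ?_, ?_, fun t ht => ?_⟩
  · refine hrev _ (Fin.rev_rev w).symm (funext fun ℓ => ?_)
    simpa [activeBits] using congrFun h0 (Sum.inr ℓ)
  · rintro (ℓ | ℓ) hℓ
    · simpa [activeBits] using congrFun hmask ℓ
    · simp at hℓ
  · simp only [Bool.and_eq_true, Bool.not_eq_true'] at ht
    have := sum_activeBits_sub_eq_zero (hX t ht.1)
    rwa [ht.2] at this

/-- A wrong bit was sent in phase one or in phase two, according to whether `w` has cached it. The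
difference of the candidates as combined in that phase is nonzero and vanishes on the bits known to
the receiver. -/
lemma strong_confusable {w : Fin 2} {first : Fin n → Bool} {G : Fin n → BitPos m w → ZMod 2}
    {W : Messages m} {E : CacheIndex m} {S : ChannelState n}
    (h : (consistentCode (twoPhaseEnc w first G)).estimate w.rev W E S ≠ W w.rev) :
    Confusable G (Sum.elim (fun ℓ => !E w ℓ) fun _ => false) (fun t => S w.rev t && first t) ∨
    Confusable G (Sum.elim (fun ℓ => E w ℓ) fun ℓ => !E w.rev ℓ)
      (fun t => S w.rev t && !first t) := by
  obtain ⟨W', hne, hX, hE⟩ := consistentCode_error h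
  have hne' : ∃ ℓ, (W' - W) w.rev ℓ ≠ 0 := Function.ne_iff.1 (sub_ne_zero.2 hne)
  obtain ⟨ℓ₀, hℓ₀⟩ := hne'
  cases hc : E w ℓ₀
  · refine Or.inl ⟨activeBits w true (E w) (W' - W), fun h0 => ?_, ?_, fun t ht => ?_⟩
    · exact hℓ₀ (by simpa [activeBits, mask, hc] using congrFun h0 (Sum.inl ℓ₀))
    · rintro (ℓ | ℓ) hℓ
      · simp only [Sum.elim_inl] at hℓ
        simp [activeBits, mask, hℓ]
      · simp [activeBits]
    · simp only [Bool.and_eq_true] at ht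
      have := sum_activeBits_sub_eq_zero (hX t ht.1)
      rwa [ht.2] at this
  · refine Or.inr ⟨activeBits w false (E w) (W' - W), fun h0 => ?_, ?_, fun t ht => ?_⟩
    · exact hℓ₀ (by simpa [activeBits, mask, hc] using congrFun h0 (Sum.inl ℓ₀))
    · rintro (ℓ | ℓ) hℓ
      · simp only [Sum.elim_inl] at hℓ
        simp [activeBits, mask, hℓ]
      · simp only [Sum.elim_inr, Bool.not_eq_false'] at hℓ
        simp [activeBits, hE ℓ hℓ]
    · simp only [Bool.and_eq_true, Bool.not_eq_true'] at ht
      have := sum_activeBits_sub_eq_zero (hX t ht.1)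
      rwa [ht.2] at this

/-- The mean error probability of a random two-phase code, from bounds on the confusion events. -/
lemma sum_errorProb_le {δ ε : Fin 2 → ℝ} (hδ : ∀ i, 0 ≤ δ i ∧ δ i < 1)
    (hε : ∀ i, 0 ≤ ε i ∧ ε i ≤ 1) {Γ : Type*} [Fintype Γ] {T : Set (Fin 2)}
    (c : Γ → Code T m n) (i : Fin 2) (B : CacheIndex m → ChannelState n → ℝ)
    (hB : ∀ E S, ∃ P : Γ → ℝ, (∀ G, 0 ≤ P G) ∧ (∀ G W, (c G).estimate i W E S ≠ W i → 1 ≤ P G) ∧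
      ∑ G, P G ≤ Fintype.card Γ * B E S) :
    ∑ G, errorProb δ ε (c G) i ≤ Fintype.card Γ *
      ∑ E : CacheIndex m, pairWeight (fun i => 1 - ε i) E
        * ∑ S : ChannelState n, pairWeight (fun i => 1 - δ i) (k := fun _ => n) S * B E S := by
  simp_rw [errorProb_eq]
  rw [Finset.sum_comm, Finset.mul_sum]
  refine Finset.sum_le_sum fun E _ => ?_
  rw [← Finset.mul_sum, mul_left_comm]
  refine mul_le_mul_of_nonneg_left ?_ (pairWeight_nonneg
    (fun i => ⟨by linarith [(hε i).2], by linarith [(hε i).1]⟩) E)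
  rw [Finset.sum_comm, Finset.mul_sum]
  refine Finset.sum_le_sum fun S _ => ?_
  rw [← Finset.mul_sum, mul_left_comm]
  refine mul_le_mul_of_nonneg_left ?_ (pairWeight_nonneg
    (fun i => ⟨by linarith [(hδ i).2], by linarith [(hδ i).1]⟩) S)
  obtain ⟨P, hP0, hP1, hP⟩ := hB E S
  refine (Finset.sum_le_sum fun G _ => ?_).trans hP
  unfold failFraction
  rw [inv_mul_le_iff₀ (by exact_mod_cast Fintype.card_pos)]
  refine (Finset.sum_le_sum (g := fun _ => P G) fun W _ => ?_).trans_eq (by simp)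
  split_ifs with h
  · exact hP1 G W h
  · exact hP0 G

lemma tendsto_exp_neg_linear {c d : ℝ} (hc : c < 0) :
    Tendsto (fun n : ℕ => Real.exp (n * c + d)) atTop (𝓝 0) := by
  refine Real.tendsto_exp_atBot.comp (tendsto_atBot_add_const_right _ _ ?_)
  exact tendsto_natCast_atTop_atTop.atTop_mul_const_of_neg hc

/-- The expression equals s(a + b) - (b - a); the choice of `s` keeps the first term below half of b
- a. -/
lemma exists_exponent {a b : ℝ} (ha : 0 ≤ a) (hab : a < b) :
    ∃ s : ℝ, 0 < s ∧ s ≤ Real.log 2 ∧ s ≤ 1 ∧ a * (1 + s) - b * (1 - s) < 0 := by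
  have hlog : 0 < Real.log 2 := Real.log_pos one_lt_two
  have hsum : 0 < a + b := by linarith
  have hlog1 : Real.log 2 ≤ 1 := by linarith [Real.log_le_sub_one_of_pos (two_pos (α := ℝ))]
  refine ⟨min (Real.log 2) ((b - a) / (2 * (a + b))), lt_min hlog (by
    have : 0 < b - a := by linarith
    positivity), min_le_left _ _, (min_le_left _ _).trans hlog1, ?_⟩
  have h1 := mul_le_mul_of_nonneg_right
    (min_le_right (Real.log 2) ((b - a) / (2 * (a + b)))) hsum.le
  have h2 : (b - a) / (2 * (a + b)) * (a + b) = (b - a) / 2 := by field_simp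
  rw [h2] at h1
  linarith

/-- Here `α` is the mean number of unknown bits and `γ` that of received equations. The slack 1 in
`γ` absorbs the rounding of the phase length and costs the additive `s`. -/
lemma exp_tilt_le {s a b α γ : ℝ} (n : ℕ) (hs : 0 < s) (hs1 : s ≤ 1)
    (hα : α ≤ n * a) (hγ : n * b - 1 ≤ γ) :
    Real.exp (α * (s + s ^ 2) + γ * (-s + (-s) ^ 2))
      ≤ Real.exp (n * (s * (a * (1 + s) - b * (1 - s))) + s) := by
  refine Real.exp_le_exp.2 ?_
  have h1 := mul_le_mul_of_nonneg_right hα (by positivity : 0 ≤ s + s ^ 2)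
  have h2 := mul_le_mul_of_nonneg_right hγ (mul_nonneg hs.le (sub_nonneg.2 hs1))
  nlinarith [sq_nonneg s]

lemma sum_first_phase (n k : ℕ) (hk : k ≤ n) :
    ∑ t : Fin n, (if decide ((t : ℕ) < k) = true then (1 : ℝ) else 0) = k := by
  simp only [decide_eq_true_eq]
  rw [Fin.sum_univ_eq_sum_range (fun t => if t < k then (1 : ℝ) else 0) n, Finset.sum_boole]
  congr 1
  rw [show (Finset.range n).filter (· < k) = Finset.range k from ?_, Finset.card_range]
  ext t
  simp only [Finset.mem_filter, Finset.mem_range]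
  omega

lemma sum_second_phase (n k : ℕ) (hk : k ≤ n) :
    ∑ t : Fin n, (if (!decide ((t : ℕ) < k)) = true then (1 : ℝ) else 0) = n - k := by
  have := count_not fun t : Fin n => decide ((t : ℕ) < k)
  unfold count at this
  rw [this, sum_first_phase n k hk]

end Scheme

/-! ### Averaging over codes, and the inner bound. -/

section Achievability

variable {m : Fin 2 → ℕ} {n : ℕ}

/-- Caches and erasures are independent, so the mean of the product splits. -/
lemma mean_mul_le {δ ε : Fin 2 → ℝ} (hδ : ∀ i, 0 ≤ δ i ∧ δ i < 1) (i : Fin 2)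
    {Φ : CacheIndex m → ℝ} {f : (Fin n → Bool) → ℝ} (hf0 : ∀ A, 0 ≤ f A) {x y : ℝ}
    (hΦ : ∑ E : CacheIndex m, pairWeight (fun i => 1 - ε i) E * Φ E ≤ Real.exp x)
    (hf : bernoulliMean (1 - δ i) f ≤ Real.exp y) :
    ∑ E : CacheIndex m, pairWeight (fun i => 1 - ε i) E
        * ∑ S : ChannelState n, pairWeight (fun i => 1 - δ i) (k := fun _ => n) S * (Φ E * f (S i))
      ≤ Real.exp (x + y) := by
  have h : ∀ E : CacheIndex m, pairWeight (fun i => 1 - ε i) E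
        * ∑ S : ChannelState n, pairWeight (fun i => 1 - δ i) (k := fun _ => n) S * (Φ E * f (S i))
      = pairWeight (fun i => 1 - ε i) E * Φ E * bernoulliMean (1 - δ i) f := by
    intro E
    rw [← sum_pairWeight_left (fun i => 1 - δ i) (fun _ => n) i f, mul_assoc]
    congr 1
    rw [Finset.mul_sum]
    exact Finset.sum_congr rfl fun S _ => by ring
  simp_rw [h, ← Finset.sum_mul]
  rw [Real.exp_add]
  refine mul_le_mul hΦ hf ?_ (Real.exp_pos x).le
  have := bernoulliMean_le (n := n) (p := 1 - δ i) ⟨by linarith [(hδ i).2], by linarith [(hδ i).1]⟩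
    (h := fun _ => 0) (h' := f) hf0
  rwa [bernoulliMean_const] at this

lemma sum_errorProb_weak_le {δ ε : Fin 2 → ℝ} (hδ : ∀ i, 0 ≤ δ i ∧ δ i < 1)
    (hε : ∀ i, 0 ≤ ε i ∧ ε i ≤ 1) (w : Fin 2) (k : ℕ) (hk : k ≤ n) {s : ℝ} (hs : 0 < s)
    (hs1 : s ≤ 1) (hs2 : s ≤ Real.log 2) :
    ∑ G : Fin n → BitPos m w → ZMod 2, errorProb δ ε
        (consistentCode (twoPhaseEnc w (fun t => decide ((t : ℕ) < k)) G)) w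
      ≤ Fintype.card (Fin n → BitPos m w → ZMod 2) * Real.exp (m w.rev.rev * (s + s ^ 2)
        + (1 - δ w) * (n - k) * (-s + (-s) ^ 2)) := by
  classical
  have habs : |-s| ≤ 1 := by rwa [abs_neg, abs_of_pos hs]
  refine (sum_errorProb_le hδ hε _ w (fun E S =>
    (∏ k : BitPos m w, if Sum.elim (fun _ => false) (fun _ => true) k then Real.exp s else 1)
      * ∏ t, if S w t && !decide ((t : ℕ) < k) then Real.exp (-s) else 1)
    fun E S => ⟨fun G => if Confusable G (Sum.elim (fun _ => false) fun _ => true)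
      (fun t => S w t && !decide ((t : ℕ) < k)) then 1 else 0,
      fun G => by dsimp only; split_ifs <;> norm_num,
      fun G W h => by dsimp only; rw [if_pos (weak_confusable h)],
      confusable_prob_le _ _ hs.le hs2⟩).trans ?_
  refine mul_le_mul_of_nonneg_left ?_ (by positivity)
  refine mean_mul_le hδ w (f := fun A => ∏ t, if A t && !decide ((t : ℕ) < k)
    then Real.exp (-s) else 1)
    (fun A => Finset.prod_nonneg fun t _ => by split_ifs <;> positivity) ?_ ?_
  · rw [← Finset.sum_mul]
    rw [sum_pairWeight (fun i => 1 - ε i) fun i => m i.rev]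
    simp only [Fintype.prod_sum_type, Sum.elim_inl, Sum.elim_inr, if_true, Bool.false_eq_true,
      if_false, Finset.prod_const, one_pow, one_mul, Finset.card_univ, Fintype.card_fin]
    rw [← Real.exp_nat_mul]
    -- The number of unknown bits is deterministic here; `s` is weakened to `s + s ^ 2` only to
    -- match the shape of the other bounds.
    refine Real.exp_le_exp.2 (mul_le_mul_of_nonneg_left ?_ (by positivity))
    nlinarith
  · refine (bernoulliMean_exp_le ⟨by linarith [(hδ w).2], by linarith [(hδ w).1]⟩ habs
      _).trans_eq ?_
    rw [sum_second_phase n k hk]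
    congr 1
    ring

lemma sum_errorProb_strong_le {δ ε : Fin 2 → ℝ} (hδ : ∀ i, 0 ≤ δ i ∧ δ i < 1)
    (hε : ∀ i, 0 ≤ ε i ∧ ε i ≤ 1) (w : Fin 2) (k : ℕ) (hk : k ≤ n) {s r : ℝ} (hs : 0 < s)
    (hs1 : s ≤ 1) (hs2 : s ≤ Real.log 2) (hr : 0 < r) (hr1 : r ≤ 1) (hr2 : r ≤ Real.log 2) :
    ∑ G : Fin n → BitPos m w → ZMod 2, errorProb δ ε
        (consistentCode (twoPhaseEnc w (fun t => decide ((t : ℕ) < k)) G)) w.rev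
      ≤ Fintype.card (Fin n → BitPos m w → ZMod 2) *
        (Real.exp (ε w * m w.rev * (s + s ^ 2) + (1 - δ w.rev) * k * (-s + (-s) ^ 2))
        + Real.exp (((1 - ε w) * m w.rev + ε w.rev * m w.rev.rev) * (r + r ^ 2)
          + (1 - δ w.rev) * (n - k) * (-r + (-r) ^ 2))) := by
  classical
  have habs : |-s| ≤ 1 := by rwa [abs_neg, abs_of_pos hs]
  have habs' : |-r| ≤ 1 := by rwa [abs_neg, abs_of_pos hr]
  have hp : 0 ≤ 1 - δ w.rev ∧ 1 - δ w.rev ≤ 1 :=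
    ⟨by linarith [(hδ w.rev).2], by linarith [(hδ w.rev).1]⟩
  have hq : ∀ i, 0 ≤ 1 - ε i ∧ 1 - ε i ≤ 1 := fun i =>
    ⟨by linarith [(hε i).2], by linarith [(hε i).1]⟩
  refine (sum_errorProb_le hδ hε _ w.rev (fun E S =>
    (∏ k : BitPos m w, if Sum.elim (fun ℓ => !E w ℓ) (fun _ => false) k then Real.exp s else 1)
      * (∏ t, if S w.rev t && decide ((t : ℕ) < k) then Real.exp (-s) else 1)
    + (∏ k : BitPos m w, if Sum.elim (fun ℓ => E w ℓ) (fun ℓ => !E w.rev ℓ) k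
        then Real.exp r else 1)
      * ∏ t, if S w.rev t && !decide ((t : ℕ) < k) then Real.exp (-r) else 1)
    fun E S => ⟨fun G => (if Confusable G (Sum.elim (fun ℓ => !E w ℓ) fun _ => false)
      (fun t => S w.rev t && decide ((t : ℕ) < k)) then 1 else 0)
      + if Confusable G (Sum.elim (fun ℓ => E w ℓ) fun ℓ => !E w.rev ℓ)
      (fun t => S w.rev t && !decide ((t : ℕ) < k)) then 1 else 0, ?_, ?_, ?_⟩).trans ?_
  · intro G
    refine add_nonneg ?_ ?_ <;> split_ifs <;> norm_num
  · intro G W h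
    dsimp only
    rcases strong_confusable h with h | h
    · rw [if_pos h]
      exact le_add_of_nonneg_right (by split_ifs <;> norm_num)
    · rw [if_pos h]
      exact le_add_of_nonneg_left (by split_ifs <;> norm_num)
  · rw [Finset.sum_add_distrib, mul_add]
    exact add_le_add (confusable_prob_le _ _ hs.le hs2) (confusable_prob_le _ _ hr.le hr2)
  refine mul_le_mul_of_nonneg_left ?_ (by positivity)
  simp_rw [mul_add, Finset.sum_add_distrib, mul_add, Finset.sum_add_distrib]
  refine add_le_add ?_ ?_
  · refine mean_mul_le hδ w.rev (f := fun A => ∏ t, if A t && decide ((t : ℕ) < k)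
      then Real.exp (-s) else 1)
      (fun A => Finset.prod_nonneg fun t _ => by split_ifs <;> positivity) ?_ ?_
    · simp only [Fintype.prod_sum_type, Sum.elim_inl, Sum.elim_inr, Bool.false_eq_true,
        if_false, Finset.prod_const, one_pow, mul_one]
      refine (sum_pairWeight_left (fun i => 1 - ε i) (fun i => m i.rev) w fun A =>
        ∏ ℓ, if !A ℓ then Real.exp s else 1).trans_le ?_
      refine (bernoulliMean_exp_not_le (hq w) (by rwa [abs_of_pos hs])).trans_eq ?_
      congr 1
      ring
    · refine (bernoulliMean_exp_le hp habs _).trans_eq ?_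
      rw [sum_first_phase n k hk]
      congr 1
      ring
  · refine mean_mul_le hδ w.rev (f := fun A => ∏ t, if A t && !decide ((t : ℕ) < k)
      then Real.exp (-r) else 1)
      (fun A => Finset.prod_nonneg fun t _ => by split_ifs <;> positivity) ?_ ?_
    · simp only [Fintype.prod_sum_type, Sum.elim_inl, Sum.elim_inr]
      refine (sum_pair_bernoulli (fun i => 1 - ε i) (fun i => m i.rev) w
        (fun A => ∏ ℓ, if A ℓ then Real.exp r else 1)
        (fun A => ∏ ℓ, if !A ℓ then Real.exp r else 1)).trans_le ?_
      have h1 := bernoulliMean_exp_le (n := m w.rev) (hq w) (x := r) (by rwa [abs_of_pos hr])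
        fun _ => true
      have h2 := bernoulliMean_exp_not_le (n := m w.rev.rev) (hq w.rev) (x := r)
        (by rwa [abs_of_pos hr])
      simp only [Bool.and_true, if_true, Finset.sum_const, Finset.card_univ, Fintype.card_fin,
        nsmul_eq_mul, mul_one] at h1
      have h0 := bernoulliMean_le (n := m w.rev.rev) (hq w.rev) (h := fun _ => 0)
        (h' := fun A => ∏ ℓ, if !A ℓ then Real.exp r else 1)
        fun A => Finset.prod_nonneg fun t _ => by split_ifs <;> positivity
      rw [bernoulliMean_const] at h0
      refine (mul_le_mul h1 h2 h0 (Real.exp_pos _).le).trans_eq ?_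
      rw [← Real.exp_add]
      congr 1
      ring
    · refine (bernoulliMean_exp_le hp habs' _).trans_eq ?_
      rw [sum_second_phase n k hk]
      congr 1
      ring

lemma errorProb_nonneg {δ ε : Fin 2 → ℝ} (hδ : ∀ i, 0 ≤ δ i ∧ δ i < 1)
    (hε : ∀ i, 0 ≤ ε i ∧ ε i ≤ 1) {T : Set (Fin 2)} (c : Code T m n) (i : Fin 2) :
    0 ≤ errorProb δ ε c i := by
  rw [errorProb_eq]
  refine Finset.sum_nonneg fun E _ => mul_nonneg (pairWeight_nonneg
    (fun i => ⟨by linarith [(hε i).2], by linarith [(hε i).1]⟩) E)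
    (Finset.sum_nonneg fun S _ => mul_nonneg (pairWeight_nonneg
      (fun i => ⟨by linarith [(hδ i).2], by linarith [(hδ i).1]⟩) S) ?_)
  unfold failFraction
  exact mul_nonneg (by positivity) (Finset.sum_nonneg fun W _ => by split_ifs <;> norm_num)

lemma exists_le_of_sum_le_card_mul {Γ : Type*} [Fintype Γ] [Nonempty Γ] {f : Γ → ℝ} {D : ℝ}
    (h : ∑ G, f G ≤ Fintype.card Γ * D) : ∃ G, f G ≤ D := by
  obtain ⟨G, -, hG⟩ := Finset.exists_le_of_sum_le (g := fun _ => D) Finset.univ_nonempty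
    (h.trans_eq (by simp))
  exact ⟨G, hG⟩

/-- The mean is taken of the sum of both error probabilities, so a single matrix serves both
receivers. -/
lemma exists_code_le {δ ε : Fin 2 → ℝ} (hδ : ∀ i, 0 ≤ δ i ∧ δ i < 1)
    (hε : ∀ i, 0 ≤ ε i ∧ ε i ≤ 1) (w : Fin 2) (k : ℕ) (hk : k ≤ n) {s r v : ℝ} (hs : 0 < s)
    (hs1 : s ≤ 1) (hs2 : s ≤ Real.log 2) (hr : 0 < r) (hr1 : r ≤ 1) (hr2 : r ≤ Real.log 2)
    (hv : 0 < v) (hv1 : v ≤ 1) (hv2 : v ≤ Real.log 2) :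
    ∃ c : Code {w} m n, ∀ i, errorProb δ ε c i ≤
      Real.exp (m w.rev.rev * (v + v ^ 2) + (1 - δ w) * (n - k) * (-v + (-v) ^ 2))
      + (Real.exp (ε w * m w.rev * (s + s ^ 2) + (1 - δ w.rev) * k * (-s + (-s) ^ 2))
        + Real.exp (((1 - ε w) * m w.rev + ε w.rev * m w.rev.rev) * (r + r ^ 2)
          + (1 - δ w.rev) * (n - k) * (-r + (-r) ^ 2))) := by
  have htot := add_le_add (sum_errorProb_weak_le (m := m) hδ hε w k hk hv hv1 hv2)
    (sum_errorProb_strong_le (m := m) hδ hε w k hk hs hs1 hs2 hr hr1 hr2)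
  rw [← Finset.sum_add_distrib, ← mul_add] at htot
  obtain ⟨G, hG⟩ := exists_le_of_sum_le_card_mul htot
  refine ⟨consistentCode (twoPhaseEnc w (fun t => decide ((t : ℕ) < k)) G), fun i => ?_⟩
  have hi : i = w ∨ i = w.rev := by
    clear * -
    revert i w; decide
  have hw0 := errorProb_nonneg hδ hε
    (consistentCode (twoPhaseEnc w (fun t => decide ((t : ℕ) < k)) G)) w
  have hs0 := errorProb_nonneg hδ hε
    (consistentCode (twoPhaseEnc w (fun t => decide ((t : ℕ) < k)) G)) w.rev
  rcases hi with rfl | rfl <;> linarith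

/-- Random two-phase coding achieves the interior of the region. -/
lemma achievable_of_lt {δ ε R : Fin 2 → ℝ} (hδ : ∀ i, 0 ≤ δ i ∧ δ i < 1)
    (hε : ∀ i, 0 ≤ ε i ∧ ε i ≤ 1) (w : Fin 2) (hR : ∀ i, 0 ≤ R i)
    (h1 : ε w.rev * R w + R w.rev < 1 - δ w.rev)
    (h2 : R w / (1 - δ w) + ε w * R w.rev / (1 - δ w.rev) < 1) :
    Achievable {w} δ ε R := by
  have hp : ∀ i, 0 < 1 - δ i := fun i => by linarith [(hδ i).2]
  have hp1 : ∀ i, 1 - δ i ≤ 1 := fun i => by linarith [(hδ i).1]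
  have hrr : R w.rev.rev = R w := by rw [Fin.rev_rev]
  -- `τ` is the share of phase one. The lower bound lets w̄ solve phase one; the upper bounds let w̄
  -- and `w` solve phase two. The interval is nonempty by `h1` and `h2` respectively.
  obtain ⟨τ, hτ1, hτ2⟩ : ∃ τ, ε w * R w.rev / (1 - δ w.rev) < τ ∧
      τ < min (1 - ((1 - ε w) * R w.rev + ε w.rev * R w) / (1 - δ w.rev))
        (1 - R w / (1 - δ w)) := by
    refine exists_between (lt_min ?_ (by linarith))
    rw [lt_sub_iff_add_lt, ← add_div, div_lt_one (hp _)]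
    linarith
  obtain ⟨hτ2, hτ3⟩ := lt_min_iff.1 hτ2
  have hτ0 : 0 ≤ τ := (div_nonneg (mul_nonneg (hε w).1 (hR _)) (hp _).le).trans hτ1.le
  have hτle : τ ≤ 1 := by linarith [div_nonneg (hR w) (hp w).le]
  have ha1 : ε w * R w.rev < τ * (1 - δ w.rev) := (div_lt_iff₀ (hp _)).1 hτ1
  have ha2 : (1 - ε w) * R w.rev + ε w.rev * R w < (1 - τ) * (1 - δ w.rev) :=
    (div_lt_iff₀ (hp _)).1 (by linarith)
  have ha3 : R w < (1 - τ) * (1 - δ w) := (div_lt_iff₀ (hp _)).1 (by linarith)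
  have hεw : 0 ≤ 1 - ε w := by linarith [(hε w).2]
  obtain ⟨s, hs, hs2, hs1, hsc⟩ := exists_exponent (mul_nonneg (hε w).1 (hR _)) ha1
  obtain ⟨r, hr, hr2, hr1, hrc⟩ := exists_exponent
    (add_nonneg (mul_nonneg hεw (hR _)) (mul_nonneg (hε _).1 (hR _))) ha2
  obtain ⟨v, hv, hv2, hv1, hvc⟩ := exists_exponent (hR w) ha3
  have hlim := ((tendsto_exp_neg_linear (d := v) (mul_neg_of_pos_of_neg hv hvc)).add
    ((tendsto_exp_neg_linear (d := s) (mul_neg_of_pos_of_neg hs hsc)).add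
    (tendsto_exp_neg_linear (d := r) (mul_neg_of_pos_of_neg hr hrc))))
  rw [add_zero, add_zero] at hlim
  have key : ∀ n : ℕ, ∃ c : Code {w} (fun i => ⌊(n : ℝ) * R i⌋₊) n, ∀ i, errorProb δ ε c i ≤
      Real.exp (n * (v * (R w * (1 + v) - (1 - τ) * (1 - δ w) * (1 - v))) + v)
      + (Real.exp (n * (s * (ε w * R w.rev * (1 + s) - τ * (1 - δ w.rev) * (1 - s))) + s)
      + Real.exp (n * (r * (((1 - ε w) * R w.rev + ε w.rev * R w) * (1 + r)
        - (1 - τ) * (1 - δ w.rev) * (1 - r))) + r)) := by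
    intro n
    have hkτ : (⌊τ * n⌋₊ : ℝ) ≤ τ * n := Nat.floor_le (by positivity)
    have hkτ' : τ * n - 1 ≤ (⌊τ * n⌋₊ : ℝ) := (Nat.sub_one_lt_floor _).le
    have hn0 : (0 : ℝ) ≤ n := by positivity
    have hk : ⌊τ * n⌋₊ ≤ n := by
      have : (⌊τ * n⌋₊ : ℝ) ≤ n := hkτ.trans (mul_le_of_le_one_left hn0 hτle)
      exact_mod_cast this
    generalize ⌊τ * n⌋₊ = k at hkτ hkτ' hk
    have hm : ∀ i, (⌊(n : ℝ) * R i⌋₊ : ℝ) ≤ n * R i := fun i =>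
      Nat.floor_le (mul_nonneg hn0 (hR i))
    have hm' : (⌊(n : ℝ) * R w.rev.rev⌋₊ : ℝ) ≤ n * R w := (hm _).trans_eq (by rw [hrr])
    have e1 := exp_tilt_le n hv hv1 hm' (γ := (1 - δ w) * (n - k))
      (b := (1 - τ) * (1 - δ w)) (by linarith [mul_le_mul_of_nonneg_left hkτ (hp w).le])
    have e2 := exp_tilt_le n hs hs1 (α := ε w * (⌊(n : ℝ) * R w.rev⌋₊ : ℝ)) (a := ε w * R w.rev)
      (by linarith [mul_le_mul_of_nonneg_left (hm w.rev) (hε w).1])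
      (γ := (1 - δ w.rev) * k) (b := τ * (1 - δ w.rev))
        (by linarith [mul_le_mul_of_nonneg_left hkτ' (hp w.rev).le, hp1 w.rev])
    have e3 := exp_tilt_le n hr hr1
      (α := (1 - ε w) * (⌊(n : ℝ) * R w.rev⌋₊ : ℝ) + ε w.rev * (⌊(n : ℝ) * R w.rev.rev⌋₊ : ℝ))
      (a := (1 - ε w) * R w.rev + ε w.rev * R w)
      (by linarith [mul_le_mul_of_nonneg_left (hm w.rev) hεw,
        mul_le_mul_of_nonneg_left hm' (hε w.rev).1])
      (γ := (1 - δ w.rev) * (n - k)) (b := (1 - τ) * (1 - δ w.rev))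
        (by linarith [mul_le_mul_of_nonneg_left hkτ (hp w.rev).le])
    obtain ⟨c, hc⟩ := exists_code_le (m := fun i => ⌊(n : ℝ) * R i⌋₊) hδ hε w k hk
      hs hs1 hs2 hr hr1 hr2 hv hv1 hv2
    exact ⟨c, fun i => (hc i).trans (add_le_add e1 (add_le_add e2 e3))⟩
  choose c hc using key
  exact ⟨hR, c, fun i => squeeze_zero (fun n => errorProb_nonneg hδ hε (c n) i)
    (fun n => hc n i) hlim⟩

/-- The encoder and the decoders may ignore additional side information. -/
lemma Achievable.mono {T T' : Set (Fin 2)} (h : T ⊆ T') {δ ε R : Fin 2 → ℝ}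
    (hR : Achievable T δ ε R) : Achievable T' δ ε R := by
  obtain ⟨hR0, c, hc⟩ := hR
  exact ⟨hR0, fun n =>
    { enc := fun W E => (c n).enc W fun j => E ⟨j, h j.2⟩
      dec := fun i Y S cache Eown ETx => (c n).dec i Y S cache Eown fun j => ETx ⟨j, h j.2⟩ }, hc⟩

lemma capacityRegion_mono {T T' : Set (Fin 2)} (h : T ⊆ T') (δ ε : Fin 2 → ℝ) :
    capacityRegion T δ ε ⊆ capacityRegion T' δ ε :=
  closure_mono fun _ hR => Achievable.mono h hR

lemma polytope_subset_semiBlindRegion {δ ε : Fin 2 → ℝ} (hδ : ∀ i, 0 ≤ δ i ∧ δ i < 1)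
    (hε : ∀ i, 0 ≤ ε i ∧ ε i ≤ 1) (w : Fin 2) (hw : δ w.rev ≤ δ w) :
    polytope δ ε ⊆ semiBlindRegion w δ ε := by
  intro R hR
  obtain ⟨hR0, hR1⟩ := hR
  have hp : ∀ i, 0 < 1 - δ i := fun i => by linarith [(hδ i).2]
  have h1 := hR1 w
  have h2 := hR1 w.rev
  unfold beta at h1 h2
  -- The ordering of the receivers decides both minima: the coefficient of `R w` becomes `ε w.rev`,
  -- and that of `R w.rev` keeps the ratio of the channel rates.
  rw [min_eq_right ((one_le_div (hp w)).2 (by linarith)), mul_one] at h1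
  rw [Fin.rev_rev, min_eq_left ((div_le_one (hp w.rev)).2 (by linarith))] at h2
  have h2' : R w / (1 - δ w) + ε w * R w.rev / (1 - δ w.rev) ≤ 1 := by
    have hw0 := (hp w).ne'
    have hs0 := (hp w.rev).ne'
    have : R w / (1 - δ w) + ε w * R w.rev / (1 - δ w.rev)
        = (ε w * ((1 - δ w) / (1 - δ w.rev)) * R w.rev + R w) / (1 - δ w) := by
      field_simp
      ring
    rw [this]
    exact (div_le_one (hp w)).2 h2
  -- Scaling towards the origin makes both inequalities strict, since their right-hand sides are
  -- positive; the closure recovers the boundary.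
  have hlim : Tendsto (fun n : ℕ => ((n : ℝ) / (n + 1)) • R) atTop (𝓝 R) := by
    have := (tendsto_natCast_div_add_atTop (1 : ℝ)).smul_const R
    rwa [one_smul] at this
  refine mem_closure_of_tendsto hlim (Eventually.of_forall fun n => ?_)
  have hl0 : (0 : ℝ) ≤ n / (n + 1) := by positivity
  have hl1 : (n : ℝ) / (n + 1) < 1 := (div_lt_one (by positivity)).2 (by linarith)
  generalize (n : ℝ) / (n + 1) = l at hl0 hl1
  refine achievable_of_lt hδ hε w (fun i => mul_nonneg hl0 (hR0 i)) ?_ ?_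
  · simp only [Pi.smul_apply, smul_eq_mul]
    nlinarith [hp w.rev, mul_le_mul_of_nonneg_left h1 hl0]
  · simp only [Pi.smul_apply, smul_eq_mul]
    have : l * R w / (1 - δ w) + ε w * (l * R w.rev) / (1 - δ w.rev)
        = l * (R w / (1 - δ w) + ε w * R w.rev / (1 - δ w.rev)) := by ring
    rw [this]
    nlinarith [mul_le_mul_of_nonneg_left h2' hl0]

end Achievability

end ErasureBC

theorem corollary1 (δ ε : Fin 2 → ℝ)
    (hδ : ∀ i, 0 ≤ δ i ∧ δ i < 1) (hε : ∀ i, 0 ≤ ε i ∧ ε i ≤ 1)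
    (w : Fin 2) (hw : δ w.rev ≤ δ w) :
    ErasureBC.semiBlindRegion w δ ε = ErasureBC.nonBlindRegion δ ε ∧
      ErasureBC.nonBlindRegion δ ε = ErasureBC.polytope δ ε := by
  have hin := ErasureBC.polytope_subset_semiBlindRegion hδ hε w hw
  have hmono : ErasureBC.semiBlindRegion w δ ε ⊆ ErasureBC.nonBlindRegion δ ε :=
    ErasureBC.capacityRegion_mono (Set.subset_univ _) δ ε
  have hout : ErasureBC.nonBlindRegion δ ε ⊆ ErasureBC.polytope δ ε :=
    ErasureBC.capacityRegion_subset_polytope hδ hε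
  exact ⟨hmono.antisymm (hout.trans hin), hout.antisymm (hin.trans hmono)⟩
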